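/- All Lie algebras and Lie groups are real. For a Lie group $G$ with Lie algebra $\mathfrak g$, the coadjoint representation on $\mathfrak g^*$ is $K_g(F)=F\circ \mathrm{Ad}(g^{-1})$, and the coadjoint orbits are $\Omega_F=\{K_g(F): g\in G\}$ for $F\in\mathfrak g^*$, with $\dim\Omega_F$ the rank of the orbit map $g\mapsto K_g(F)$, i.e. the dimension of the tangent space of $\Omega_F$. An $\mathrm{MD}_k(n)$-algebra is the Lie algebra of an $n$-dimensional simply connected solvable Lie group all of whose non-trivial coadjoint orbits (those that are not a single point) have dimension $k$. Let $\mathfrak h_{2m+1}$ be the Heisenberg algebra with basis $x_1,\dots,x_m,y_1,\dots,y_m,z$ and non-zero brackets $[x_i,y_i]=z$ for $1\le i\le m$; let $\mathrm{aff}(\mathbb C)$ be the real Lie algebra with basis $x_1,x_2,y_1,y_2$ and non-zero brackets $[x_1,y_1]=y_1$, $[x_1,y_2]=y_2$, $[x_2,y_1]=-y_2$, $[x_2,y_2]=y_1$ (up to antisymmetry in both cases); and let $\mathbb R^k$ denote the commutative Lie algebra of dimension $k$. Let $n\ge 6$, let $\mathcal G$ be an $\mathrm{MD}_{n-2}(n)$-algebra,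 and let $\mathcal G^1=[\mathcal G,\mathcal G]$. 1. If $\dim\mathcal G^1=1$, then $n$ is even and $\mathcal G\cong\mathfrak h_{2m+1}\oplus\mathbb R$ with $m=\frac{n-2}{2}$. 2. If $\dim\mathcal G^1=2$ and $\mathcal G^1$ is not contained in the centre of $\mathcal G$, then $\mathcal G\cong\mathrm{aff}(\mathbb C)\oplus\mathbb R^2$. -/

import Mathlib

open scoped Manifold ContDiff

/-! ### Coadjoint orbits of a real Lie group -/

section Coadjoint

variable {E : Type*} [NormedAddCommGroup E] [NormedSpace ℝ E]
  {G : Type*} [Group G] [TopologicalSpace G] [ChartedSpace E G]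

/-- Over `ℝ`, a smooth Lie group is regular enough for its tangent space at the identity,
`GroupLieAlgebra 𝓘(ℝ, E) G`, to carry the usual Lie algebra structure of Mathlib. -/
instance instLieGroupMinSmoothness [LieGroup 𝓘(ℝ, E) ∞ G] :
    LieGroup 𝓘(ℝ, E) (minSmoothness ℝ 3) G := by
  rw [minSmoothness_of_isRCLikeNormedField]
  infer_instance

/-- The adjoint representation `Ad g : 𝔤 → 𝔤`, the differential at the identity of the conjugation
`h ↦ g h g⁻¹`.  The underlying vector space of `𝔤 = GroupLieAlgebra 𝓘(ℝ, E) G` (the tangent space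
at the identity) is by definition the model space `E`, and we write `E` for it here, so that its
dual is available as a normed space. -/
noncomputable def adjointRep (g : G) : E →L[ℝ] E :=
  mfderiv 𝓘(ℝ, E) 𝓘(ℝ, E) (fun h : G => g * h * g⁻¹) (1 : G)

/-- The coadjoint representation on `𝔤*`: `K_g F = F ∘ Ad (g⁻¹)`. -/
noncomputable def coadjointRep (g : G) (F : StrongDual ℝ E) : StrongDual ℝ E :=
  F.comp (adjointRep g⁻¹)

variable (G) in
/-- The coadjoint orbit `Ω_F = {K_g F : g ∈ G}`. -/
def coadjointOrbit (F : StrongDual ℝ E) : Set (StrongDual ℝ E) :=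
  Set.range fun g : G => coadjointRep g F

variable (G) in
/-- The tangent space at `F` of the coadjoint orbit `Ω_F` (with its structure of homogeneous
manifold of `G`): the image of the differential at the identity of the orbit map `g ↦ K_g F`. -/
noncomputable def coadjointOrbitTangent (F : StrongDual ℝ E) : Submodule ℝ (StrongDual ℝ E) :=
  LinearMap.range
    (mfderiv 𝓘(ℝ, E) 𝓘(ℝ, StrongDual ℝ E) (fun g : G => coadjointRep g F) (1 : G) :
      E →L[ℝ] StrongDual ℝ E).toLinearMap

variable (G) in
/-- The dimension of the coadjoint orbit `Ω_F`. -/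
noncomputable def coadjointOrbitDim (F : StrongDual ℝ E) : ℕ :=
  Module.finrank ℝ (coadjointOrbitTangent G F)

end Coadjoint

/-! ### MD-groups and MD-algebras -/

/-- A simply connected solvable Lie group all of whose non-trivial coadjoint orbits have
dimension `k`. -/
structure IsMDGroup (E : Type*) [NormedAddCommGroup E] [NormedSpace ℝ E] (k : ℕ)
    (G : Type*) [Group G] [TopologicalSpace G] [ChartedSpace E G] [LieGroup 𝓘(ℝ, E) ∞ G] :
    Prop where
  simplyConnected : SimplyConnectedSpace G
  solvable : Group.IsSolvable G
  orbit_dim : ∀ F : StrongDual ℝ E,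
    (coadjointOrbit G F).Nontrivial → coadjointOrbitDim G F = k

universe u v

/-- `L` is an `MD_k(n)`-algebra: it is (isomorphic to) the Lie algebra of an `n`-dimensional
simply connected solvable Lie group whose non-trivial coadjoint orbits all have dimension `k`. -/
def IsMDAlgebra (k n : ℕ) (L : Type u) [LieRing L] [LieAlgebra ℝ L] : Prop :=
  ∃ (G : Type v) (_ : Group G) (_ : TopologicalSpace G)
    (_ : ChartedSpace (EuclideanSpace ℝ (Fin n)) G)
    (_ : LieGroup 𝓘(ℝ, EuclideanSpace ℝ (Fin n)) ∞ G),
    IsMDGroup (EuclideanSpace ℝ (Fin n)) k G ∧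
      Nonempty (GroupLieAlgebra 𝓘(ℝ, EuclideanSpace ℝ (Fin n)) G ≃ₗ⁅ℝ⁆ L)

/-! ### The Heisenberg algebra -/

/-- The real Heisenberg algebra `𝔥_{2m+1}`: the vectors `∑ i, x i • x_i + ∑ i, y i • y_i + z • z`
in the basis `x_1, …, x_m, y_1, …, y_m, z`. -/
@[ext]
structure HeisenbergAlgebra (m : ℕ) where
  x : Fin m → ℝ
  y : Fin m → ℝ
  z : ℝ

namespace HeisenbergAlgebra

variable {m : ℕ}

/-- The coordinates, through which the vector space structure is defined. -/
def equivProd (m : ℕ) : HeisenbergAlgebra m ≃ (Fin m → ℝ) × (Fin m → ℝ) × ℝ where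
  toFun a := (a.x, a.y, a.z)
  invFun p := ⟨p.1, p.2.1, p.2.2⟩
  left_inv _ := rfl
  right_inv _ := rfl

noncomputable instance : AddCommGroup (HeisenbergAlgebra m) := (equivProd m).addCommGroup

noncomputable instance : Module ℝ (HeisenbergAlgebra m) := (equivProd m).module ℝ

/-- `[x_i, y_i] = z` for every `i`, and the other brackets of basis vectors vanish. -/
noncomputable instance : Bracket (HeisenbergAlgebra m) (HeisenbergAlgebra m) where
  bracket a b := ⟨0, 0, ∑ i, (a.x i * b.y i - b.x i * a.y i)⟩

@[simp] theorem x_zero : (0 : HeisenbergAlgebra m).x = 0 := rfl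
@[simp] theorem y_zero : (0 : HeisenbergAlgebra m).y = 0 := rfl
@[simp] theorem z_zero : (0 : HeisenbergAlgebra m).z = 0 := rfl
@[simp] theorem x_add (a b : HeisenbergAlgebra m) : (a + b).x = a.x + b.x := rfl
@[simp] theorem y_add (a b : HeisenbergAlgebra m) : (a + b).y = a.y + b.y := rfl
@[simp] theorem z_add (a b : HeisenbergAlgebra m) : (a + b).z = a.z + b.z := rfl
@[simp] theorem x_smul (t : ℝ) (a : HeisenbergAlgebra m) : (t • a).x = t • a.x := rfl
@[simp] theorem y_smul (t : ℝ) (a : HeisenbergAlgebra m) : (t • a).y = t • a.y := rfl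
@[simp] theorem z_smul (t : ℝ) (a : HeisenbergAlgebra m) : (t • a).z = t • a.z := rfl
@[simp] theorem x_lie (a b : HeisenbergAlgebra m) : ⁅a, b⁆.x = 0 := rfl
@[simp] theorem y_lie (a b : HeisenbergAlgebra m) : ⁅a, b⁆.y = 0 := rfl
theorem z_lie (a b : HeisenbergAlgebra m) :
    ⁅a, b⁆.z = ∑ i, (a.x i * b.y i - b.x i * a.y i) := rfl

noncomputable instance : LieRing (HeisenbergAlgebra m) where
  add_lie a b c := by
    ext
    · simp
    · simp
    · simp only [z_lie, z_add, x_add, y_add, Pi.add_apply, ← Finset.sum_add_distrib]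
      exact Finset.sum_congr rfl fun i _ => by ring
  lie_add a b c := by
    ext
    · simp
    · simp
    · simp only [z_lie, z_add, x_add, y_add, Pi.add_apply, ← Finset.sum_add_distrib]
      exact Finset.sum_congr rfl fun i _ => by ring
  lie_self a := by
    ext
    · simp
    · simp
    · simp [z_lie]
  leibniz_lie a b c := by
    ext
    · simp
    · simp
    · simp [z_lie]

noncomputable instance : LieAlgebra ℝ (HeisenbergAlgebra m) where
  lie_smul t a b := by
    ext
    · simp
    · simp
    · simp only [z_lie, z_smul, x_smul, y_smul, Pi.smul_apply, smul_eq_mul, Finset.mul_sum]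
      exact Finset.sum_congr rfl fun i _ => by ring

end HeisenbergAlgebra

/-! ### The complex affine algebra -/

/-- The Lie algebra `aff(ℂ)` of the group of affine maps `w ↦ c w + d` of `ℂ`, as a real Lie
algebra of dimension `4`: the element `⟨a, b⟩` stands for the matrix `!![a, b; 0, 0]`. -/
@[ext]
structure AffineAlgebraComplex where
  a : ℂ
  b : ℂ

namespace AffineAlgebraComplex

/-- The coordinates, through which the vector space structure is defined. -/
def equivProd : AffineAlgebraComplex ≃ ℂ × ℂ where
  toFun p := (p.a, p.b)
  invFun p := ⟨p.1, p.2⟩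
  left_inv _ := rfl
  right_inv _ := rfl

noncomputable instance : AddCommGroup AffineAlgebraComplex := equivProd.addCommGroup

noncomputable instance : Module ℝ AffineAlgebraComplex := equivProd.module ℝ

/-- The commutator of the matrices `!![a, b; 0, 0]`.  In the real basis `x₁ = ⟨1, 0⟩`,
`x₂ = ⟨-i, 0⟩`, `y₁ = ⟨0, 1⟩`, `y₂ = ⟨0, i⟩` it reads `[x₁, y₁] = y₁`, `[x₁, y₂] = y₂`,
`[x₂, y₁] = -y₂`, `[x₂, y₂] = y₁`, the other brackets of basis vectors being zero. -/
noncomputable instance : Bracket AffineAlgebraComplex AffineAlgebraComplex where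
  bracket p q := ⟨0, p.a * q.b - q.a * p.b⟩

@[simp] theorem a_zero : (0 : AffineAlgebraComplex).a = 0 := rfl
@[simp] theorem b_zero : (0 : AffineAlgebraComplex).b = 0 := rfl
@[simp] theorem a_add (p q : AffineAlgebraComplex) : (p + q).a = p.a + q.a := rfl
@[simp] theorem b_add (p q : AffineAlgebraComplex) : (p + q).b = p.b + q.b := rfl
@[simp] theorem a_smul (t : ℝ) (p : AffineAlgebraComplex) : (t • p).a = t • p.a := rfl
@[simp] theorem b_smul (t : ℝ) (p : AffineAlgebraComplex) : (t • p).b = t • p.b := rfl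
@[simp] theorem a_lie (p q : AffineAlgebraComplex) : ⁅p, q⁆.a = 0 := rfl
@[simp] theorem b_lie (p q : AffineAlgebraComplex) : ⁅p, q⁆.b = p.a * q.b - q.a * p.b := rfl

noncomputable instance : LieRing AffineAlgebraComplex where
  add_lie p q r := by
    ext1
    · simp
    · simp only [b_lie, b_add, a_add]; ring
  lie_add p q r := by
    ext1
    · simp
    · simp only [b_lie, b_add, a_add]; ring
  lie_self p := by
    ext1
    · simp
    · simp
  leibniz_lie p q r := by
    ext1
    · simp
    · simp only [b_lie, a_lie, b_add]; ring

noncomputable instance : LieAlgebra ℝ AffineAlgebraComplex where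
  lie_smul t p q := by
    ext1
    · simp
    · simp only [b_lie, b_smul, a_smul, Complex.real_smul]; ring

end AffineAlgebraComplex

/-! ### Commutative Lie algebras -/

/-- The vector space `ℝ^k`, viewed as a commutative Lie algebra. -/
def AbelianAlgebra (k : ℕ) : Type := Fin k → ℝ

namespace AbelianAlgebra

variable {k : ℕ}

noncomputable instance : AddCommGroup (AbelianAlgebra k) :=
  inferInstanceAs (AddCommGroup (Fin k → ℝ))

noncomputable instance : Module ℝ (AbelianAlgebra k) :=
  inferInstanceAs (Module ℝ (Fin k → ℝ))

noncomputable instance : LieRing (AbelianAlgebra k) where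
  bracket _ _ := 0
  add_lie _ _ _ := (add_zero 0).symm
  lie_add _ _ _ := (add_zero 0).symm
  lie_self _ := rfl
  leibniz_lie _ _ _ := (add_zero 0).symm

noncomputable instance : LieAlgebra ℝ (AbelianAlgebra k) where
  lie_smul t _ _ := (smul_zero t).symm

end AbelianAlgebra

/-! The group hypothesis is used only through linear algebra. In a chart, differentiating `g * (g⁻¹
* h * g) = h * g` shows that the derivative of `g ↦ Ad g⁻¹` at the identity is `-ad`. The tangent
space of the orbit of `F` is therefore the range of `x ↦ F ⁅x, ·⁆`, and every non-zero Kirillov form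
has rank `n - 2`, so that its radical is a plane (`IsMDAlgebra.finrank_range_kirillovForm`).

If the derived algebra is a line spanned by `z`, the bracket is `F ⁅x, y⁆ • z` for a single form. By
the Jacobi identity, `z` outside the radical would force rank at most 2, whereas `n - 2 ≥ 4`. Hence
`z` is central, and a hyperbolic system, `z` and one more radical vector give the Heisenberg algebra
plus a line.

If the derived algebra is a non-central plane, it is commutative, and `L` acts on it by commuting
endomorphisms. Let `K` be the kernel of this action. It is isotropic for a form that kills the
centre but not the derived algebra, so `2 dim K ≤ n + 2`. A cyclic vector gives `dim K ≥ n - 2`.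
Hence `n = 6`, `dim K = 4`, and some `w₁` acts as the identity. The rank condition also makes every
element outside `K` act invertibly, which excludes real eigenvalues. The action is thus that of `ℂ`
on itself, and two independent central vectors of `K` complete `aff(ℂ) ⊕ ℝ²`. -/

open scoped Topology

/-! ### Second-order calculus of a local multiplication law -/

section LocalMultiplication

variable {E : Type*} [NormedAddCommGroup E] [NormedSpace ℝ E] [CompleteSpace E]

/-- If `m` is a local multiplication law with unit `x₀`, then the solution `a` of
`∂₂m(x, x₀) ∘ a x = ∂₁m(x₀, x)` is differentiable at `x₀`, and its derivative is minus the
Lie bracket of the left-invariant vector fields `x ↦ ∂₂m(x, x₀) Y`. -/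
theorem fderiv_eq_neg_lieBracket_of_comp_eq {m : E × E → E} {x₀ : E} {a : E → E →L[ℝ] E}
    (hm : ContDiffAt ℝ 2 m (x₀, x₀))
    (h₁ : fderiv ℝ m (x₀, x₀) ∘L .inl ℝ E E = .id ℝ E)
    (h₂ : fderiv ℝ m (x₀, x₀) ∘L .inr ℝ E E = .id ℝ E)
    (ha : ∀ᶠ x in 𝓝 x₀, (fderiv ℝ m (x, x₀) ∘L .inr ℝ E E) ∘L a x =
      fderiv ℝ m (x₀, x) ∘L .inl ℝ E E) :
    DifferentiableAt ℝ a x₀ ∧ ∀ X Y, fderiv ℝ a x₀ X Y =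
      - VectorField.lieBracket ℝ (fun x => fderiv ℝ m (x, x₀) (0, X))
        (fun x => fderiv ℝ m (x, x₀) (0, Y)) x₀ := by
  have hd : DifferentiableAt ℝ (fderiv ℝ m) (x₀, x₀) :=
    (hm.fderiv_right (m := 1) le_rfl).differentiableAt one_ne_zero
  have hl : HasFDerivAt (fun x => fderiv ℝ m (x, x₀))
      (fderiv ℝ (fderiv ℝ m) (x₀, x₀) ∘L .inl ℝ E E) x₀ :=
    hd.hasFDerivAt.comp (f := fun x => (x, x₀)) x₀ (hasFDerivAt_prodMk_left x₀ x₀)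
  have hr : HasFDerivAt (fun x => fderiv ℝ m (x₀, x))
      (fderiv ℝ (fderiv ℝ m) (x₀, x₀) ∘L .inr ℝ E E) x₀ :=
    hd.hasFDerivAt.comp (f := fun x => (x₀, x)) x₀ (hasFDerivAt_prodMk_right x₀ x₀)
  have hP := hl.clm_comp (hasFDerivAt_const (ContinuousLinearMap.inr ℝ E E) x₀)
  have hQ := hr.clm_comp (hasFDerivAt_const (ContinuousLinearMap.inl ℝ E E) x₀)
  set P : E → E →L[ℝ] E := fun x => fderiv ℝ m (x, x₀) ∘L .inr ℝ E E with hPdef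
  set Q : E → E →L[ℝ] E := fun x => fderiv ℝ m (x₀, x) ∘L .inl ℝ E E with hQdef
  have hP1 : P x₀ = 1 := h₂
  have hQ1 : Q x₀ = 1 := h₁
  have hunit : ∀ᶠ x in 𝓝 x₀, IsUnit (P x) :=
    hP.continuousAt.eventually (Units.isOpen.mem_nhds (by simp [hP1]))
  -- Near the unit `P` is invertible, so `a = P⁻¹ Q` inherits differentiability.
  have haeq : a =ᶠ[𝓝 x₀] fun x => Ring.inverse (P x) * Q x := by
    filter_upwards [hunit, ha] with x hx hax
    have : P x * a x = Q x := hax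
    rw [← this, ← mul_assoc, Ring.inverse_mul_cancel _ hx, one_mul]
  have hinv : DifferentiableAt ℝ (fun x => Ring.inverse (P x)) x₀ := by
    have : DifferentiableAt ℝ (Ring.inverse : (E →L[ℝ] E) → E →L[ℝ] E) (P x₀) := by
      rw [hP1]; exact differentiableAt_inverse isUnit_one
    exact this.comp x₀ hP.differentiableAt
  have hadiff : DifferentiableAt ℝ a x₀ :=
    (hinv.mul hQ.differentiableAt).congr_of_eventuallyEq haeq
  refine ⟨hadiff, fun X Y => ?_⟩
  have ha1 : a x₀ = 1 := by rw [haeq.eq_of_nhds, hP1, hQ1]; simp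
  have hPa := hP.clm_comp hadiff.hasFDerivAt
  -- Differentiating `P ∘ a = Q` expresses `a'` as a difference of mixed second derivatives of `m`;
  -- their symmetry turns it into a Lie bracket.
  have hPQ := (hPa.congr_of_eventuallyEq
    (Filter.EventuallyEq.symm ha)).unique hQ
  have key := congr($hPQ X Y)
  have hsymm := hm.isSymmSndFDerivAt (by simp) (0, X) (Y, 0)
  have hlv : ∀ v : E, fderiv ℝ (fun x => fderiv ℝ m (x, x₀) (0, v)) x₀ =
      (fderiv ℝ (fderiv ℝ m) (x₀, x₀) ∘L .inl ℝ E E).flip (0, v) := fun v => by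
    rw [(hl.clm_apply (hasFDerivAt_const (0, v) x₀)).fderiv]
    ext; simp
  have hid : ∀ v : E, fderiv ℝ m (x₀, x₀) (0, v) = v := fun v => congr($h₂ v)
  simp [ha1, hP1] at key
  simp only [VectorField.lieBracket, hlv, hid]
  simp only [ContinuousLinearMap.flip_apply, ContinuousLinearMap.comp_apply,
    ContinuousLinearMap.inl_apply, ← hsymm, ← key]
  abel

end LocalMultiplication

/-! ### The multiplication of a Lie group in the chart at the identity -/

section LieGroupCharts

variable {E : Type*} [NormedAddCommGroup E] [NormedSpace ℝ E]
  {G : Type*} [Group G] [TopologicalSpace G] [ChartedSpace E G]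

variable (E G) in
/-- The multiplication of `G` read in the preferred chart at the identity. -/
noncomputable def chartMul (p : E × E) : E :=
  extChartAt 𝓘(ℝ, E) (1 : G)
    ((extChartAt 𝓘(ℝ, E) (1 : G)).symm p.1 * (extChartAt 𝓘(ℝ, E) (1 : G)).symm p.2)

variable (E G) in
/-- The identity of `G` read in the preferred chart at the identity. -/
noncomputable def chartOne : E := extChartAt 𝓘(ℝ, E) (1 : G) 1

theorem chartOne_mem_target : chartOne E G ∈ (extChartAt 𝓘(ℝ, E) (1 : G)).target :=
  mem_extChartAt_target 1

theorem extChartAt_symm_chartOne : (extChartAt 𝓘(ℝ, E) (1 : G)).symm (chartOne E G) = 1 :=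
  extChartAt_to_inv 1

theorem chartMul_chartOne_right {x : E} (hx : x ∈ (extChartAt 𝓘(ℝ, E) (1 : G)).target) :
    chartMul E G (x, chartOne E G) = x := by
  simp only [chartMul, extChartAt_symm_chartOne, mul_one]
  exact (extChartAt 𝓘(ℝ, E) (1 : G)).right_inv hx

theorem chartMul_chartOne_left {x : E} (hx : x ∈ (extChartAt 𝓘(ℝ, E) (1 : G)).target) :
    chartMul E G (chartOne E G, x) = x := by
  simp only [chartMul, extChartAt_symm_chartOne, one_mul]
  exact (extChartAt 𝓘(ℝ, E) (1 : G)).right_inv hx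

theorem target_mem_nhds {x : E} (hx : x ∈ (extChartAt 𝓘(ℝ, E) (1 : G)).target) :
    (extChartAt 𝓘(ℝ, E) (1 : G)).target ∈ 𝓝 x :=
  (isOpen_extChartAt_target 1).mem_nhds hx

variable [LieGroup 𝓘(ℝ, E) ∞ G]

theorem contMDiffAt_extChartAt_one_symm {x : E}
    (hx : x ∈ (extChartAt 𝓘(ℝ, E) (1 : G)).target) :
    ContMDiffAt 𝓘(ℝ, E) 𝓘(ℝ, E) ∞ (extChartAt 𝓘(ℝ, E) (1 : G)).symm x :=
  (contMDiffOn_extChartAt_symm 1).contMDiffAt (target_mem_nhds hx)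

theorem contMDiffAt_extChartAt_one {g : G} (hg : g ∈ (extChartAt 𝓘(ℝ, E) (1 : G)).source) :
    ContMDiffAt 𝓘(ℝ, E) 𝓘(ℝ, E) ∞ (extChartAt 𝓘(ℝ, E) (1 : G)) g := by
  apply contMDiffAt_extChartAt'
  rwa [extChartAt_source] at hg

theorem contDiffAt_chartMul {x y : E} (hx : x ∈ (extChartAt 𝓘(ℝ, E) (1 : G)).target)
    (hy : y ∈ (extChartAt 𝓘(ℝ, E) (1 : G)).target)
    (hxy : (extChartAt 𝓘(ℝ, E) (1 : G)).symm x * (extChartAt 𝓘(ℝ, E) (1 : G)).symm y ∈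
      (extChartAt 𝓘(ℝ, E) (1 : G)).source) :
    ContDiffAt ℝ ∞ (chartMul E G) (x, y) := by
  rw [← contMDiffAt_iff_contDiffAt]
  have h1 : ContMDiffAt 𝓘(ℝ, E × E) 𝓘(ℝ, E) ∞
      (fun p : E × E => (extChartAt 𝓘(ℝ, E) (1 : G)).symm p.1) (x, y) :=
    (contMDiffAt_extChartAt_one_symm hx).comp (x, y) contDiffAt_fst.contMDiffAt
  have h2 : ContMDiffAt 𝓘(ℝ, E × E) 𝓘(ℝ, E) ∞
      (fun p : E × E => (extChartAt 𝓘(ℝ, E) (1 : G)).symm p.2) (x, y) :=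
    (contMDiffAt_extChartAt_one_symm hy).comp (x, y) contDiffAt_snd.contMDiffAt
  exact (contMDiffAt_extChartAt_one hxy).comp (x, y) (h1.mul h2)

theorem contDiffAt_chartMul_chartOne_right {x : E}
    (hx : x ∈ (extChartAt 𝓘(ℝ, E) (1 : G)).target) :
    ContDiffAt ℝ ∞ (chartMul E G) (x, chartOne E G) := by
  refine contDiffAt_chartMul hx chartOne_mem_target ?_
  rw [extChartAt_symm_chartOne, mul_one]
  exact (extChartAt 𝓘(ℝ, E) (1 : G)).map_target hx

theorem contDiffAt_chartMul_chartOne_left {x : E}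
    (hx : x ∈ (extChartAt 𝓘(ℝ, E) (1 : G)).target) :
    ContDiffAt ℝ ∞ (chartMul E G) (chartOne E G, x) := by
  refine contDiffAt_chartMul chartOne_mem_target hx ?_
  rw [extChartAt_symm_chartOne, one_mul]
  exact (extChartAt 𝓘(ℝ, E) (1 : G)).map_target hx

theorem hasFDerivAt_chartMul_right {x : E}
    (hx : x ∈ (extChartAt 𝓘(ℝ, E) (1 : G)).target) :
    HasFDerivAt (fun y => chartMul E G (x, y))
      (fderiv ℝ (chartMul E G) (x, chartOne E G) ∘L .inr ℝ E E) (chartOne E G) :=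
  ((contDiffAt_chartMul_chartOne_right hx).differentiableAt (by simp)).hasFDerivAt.comp
    (f := fun y => (x, y)) _ (hasFDerivAt_prodMk_right x _)

theorem hasFDerivAt_chartMul_left {x : E}
    (hx : x ∈ (extChartAt 𝓘(ℝ, E) (1 : G)).target) :
    HasFDerivAt (fun y => chartMul E G (y, x))
      (fderiv ℝ (chartMul E G) (chartOne E G, x) ∘L .inl ℝ E E) (chartOne E G) :=
  ((contDiffAt_chartMul_chartOne_left hx).differentiableAt (by simp)).hasFDerivAt.comp
    (f := fun y => (y, x)) _ (hasFDerivAt_prodMk_left _ x)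

theorem fderiv_chartMul_comp_inr_chartOne :
    fderiv ℝ (chartMul E G) (chartOne E G, chartOne E G) ∘L .inr ℝ E E = .id ℝ E := by
  refine (hasFDerivAt_chartMul_right (G := G) chartOne_mem_target).unique ?_
  refine (hasFDerivAt_id _).congr_of_eventuallyEq ?_
  filter_upwards [target_mem_nhds (G := G) chartOne_mem_target] with y hy
  exact chartMul_chartOne_left hy

theorem fderiv_chartMul_comp_inl_chartOne :
    fderiv ℝ (chartMul E G) (chartOne E G, chartOne E G) ∘L .inl ℝ E E = .id ℝ E := by
  refine (hasFDerivAt_chartMul_left (G := G) chartOne_mem_target).unique ?_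
  refine (hasFDerivAt_id _).congr_of_eventuallyEq ?_
  filter_upwards [target_mem_nhds (G := G) chartOne_mem_target] with y hy
  exact chartMul_chartOne_right hy

theorem contMDiff_conj (g : G) :
    ContMDiff 𝓘(ℝ, E) 𝓘(ℝ, E) ∞ (fun h : G => g * h * g⁻¹) :=
  (contMDiff_const.mul contMDiff_id).mul contMDiff_const

/-- The adjoint representation is the derivative of the conjugation read in the chart at `1`. -/
theorem hasFDerivAt_chart_conj (g : G) :
    HasFDerivAt (fun y : E => extChartAt 𝓘(ℝ, E) (1 : G)
      (g * (extChartAt 𝓘(ℝ, E) (1 : G)).symm y * g⁻¹)) (adjointRep (E := E) g)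
      (chartOne E G) := by
  have h : MDifferentiableAt 𝓘(ℝ, E) 𝓘(ℝ, E) (fun h : G => g * h * g⁻¹) 1 :=
    (contMDiff_conj g).mdifferentiableAt (by simp)
  have h' := h.hasMFDerivAt.2
  have h1 : g * 1 * g⁻¹ = 1 := by simp
  simp only [writtenInExtChartAt, h1, modelWithCornersSelf_coe, Set.range_id] at h'
  exact hasFDerivWithinAt_univ.1 h'

/-- This is the derivative at `h = 1` of `g * (g⁻¹ * h * g) = h * g`, where `x` is the coordinate of
`g`. -/
theorem fderiv_chartMul_comp_adjointRep_inv {x : E}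
    (hx : x ∈ (extChartAt 𝓘(ℝ, E) (1 : G)).target) :
    (fderiv ℝ (chartMul E G) (x, chartOne E G) ∘L .inr ℝ E E) ∘L
        adjointRep ((extChartAt 𝓘(ℝ, E) (1 : G)).symm x)⁻¹ =
      fderiv ℝ (chartMul E G) (chartOne E G, x) ∘L .inl ℝ E E := by
  refine HasFDerivAt.unique ?_ (hasFDerivAt_chartMul_left (G := G) hx)
  set φ := extChartAt 𝓘(ℝ, E) (1 : G)
  set g := φ.symm x with hg
  have hc := hasFDerivAt_chart_conj (E := E) g⁻¹
  have hone : φ (g⁻¹ * φ.symm (chartOne E G) * g⁻¹⁻¹) = chartOne E G := by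
    simp only [φ, extChartAt_symm_chartOne, mul_one, mul_inv_cancel]
    rfl
  have hr := hasFDerivAt_chartMul_right (G := G) hx
  rw [← hone] at hr
  have hcomp := HasFDerivAt.comp (chartOne E G) hr hc
  rw [hone] at hcomp
  refine hcomp.congr_of_eventuallyEq ?_
  have hcont : ContinuousAt (fun y : E => g⁻¹ * φ.symm y * g⁻¹⁻¹) (chartOne E G) :=
    (((contMDiff_conj g⁻¹).contMDiffAt).comp _
      (contMDiffAt_extChartAt_one_symm chartOne_mem_target)).continuousAt
  have hsrc : φ.source ∈ 𝓝 (g⁻¹ * φ.symm (chartOne E G) * g⁻¹⁻¹) := by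
    simp only [φ, extChartAt_symm_chartOne, mul_one, mul_inv_cancel]
    exact extChartAt_source_mem_nhds 1
  filter_upwards [hcont.preimage_mem_nhds hsrc] with y hy
  have hy' : φ.symm (φ (g⁻¹ * φ.symm y * g⁻¹⁻¹)) = g⁻¹ * φ.symm y * g⁻¹⁻¹ := φ.left_inv hy
  change φ (φ.symm y * φ.symm x) = φ (φ.symm x * φ.symm (φ (g⁻¹ * φ.symm y * g⁻¹⁻¹)))
  rw [hy', ← hg]
  congr 1
  group

/-- Left-invariant vector fields, read in the chart at the identity. -/
theorem mpullbackWithin_mulInvariantVectorField {x : E}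
    (hx : x ∈ (extChartAt 𝓘(ℝ, E) (1 : G)).target) (Y : GroupLieAlgebra 𝓘(ℝ, E) G) :
    VectorField.mpullbackWithin 𝓘(ℝ, E) 𝓘(ℝ, E) (extChartAt 𝓘(ℝ, E) (1 : G)).symm
      (mulInvariantVectorField Y) Set.univ x =
      fderiv ℝ (chartMul E G) (x, chartOne E G) ((0, Y) : E × E) := by
  set φ := extChartAt 𝓘(ℝ, E) (1 : G)
  have hinv : (mfderivWithin 𝓘(ℝ, E) 𝓘(ℝ, E) φ.symm Set.univ x).IsInvertible := by
    have := isInvertible_mfderivWithin_extChartAt_symm (I := 𝓘(ℝ, E)) hx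
    rwa [modelWithCornersSelf_coe, Set.range_id] at this
  have hone : HasMFDerivAt 𝓘(ℝ, E) 𝓘(ℝ, E) φ.symm (chartOne E G) (.id ℝ E) := by
    have h := ((contMDiffAt_extChartAt_one_symm (E := E) (G := G) chartOne_mem_target).mdifferentiableAt
      (by simp)).hasMFDerivAt
    have h' := mfderivWithin_range_extChartAt_symm (I := 𝓘(ℝ, E)) (H := E) (M := G) (x := (1 : G))
    simp only [modelWithCornersSelf_coe, Set.range_id, mfderivWithin_univ] at h'
    have h'' : (mfderiv 𝓘(ℝ, E) 𝓘(ℝ, E) φ.symm (chartOne E G) : E →L[ℝ] E) = .id ℝ E := h'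
    rw [← h'']
    exact h
  have hL : HasMFDerivAt 𝓘(ℝ, E) 𝓘(ℝ, E) (fun h : G => φ.symm x * h) (φ.symm (chartOne E G))
      (mfderiv 𝓘(ℝ, E) 𝓘(ℝ, E) (fun h : G => φ.symm x * h) (1 : G)) := by
    have : φ.symm (chartOne E G) = 1 := extChartAt_symm_chartOne (E := E)
    rw [this]
    exact ((contMDiff_mul_left (I := 𝓘(ℝ, E)) (n := ∞)).mdifferentiableAt (by simp)).hasMFDerivAt
  have h1 := hL.comp (chartOne E G) hone
  have hm : HasMFDerivAt 𝓘(ℝ, E) 𝓘(ℝ, E) (fun y => chartMul E G (x, y)) (chartOne E G)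
      (fderiv ℝ (chartMul E G) (x, chartOne E G) ∘L .inr ℝ E E) :=
    (hasFDerivAt_chartMul_right (G := G) hx).hasMFDerivAt
  have hs : HasMFDerivAt 𝓘(ℝ, E) 𝓘(ℝ, E) φ.symm (chartMul E G (x, chartOne E G))
      (mfderiv 𝓘(ℝ, E) 𝓘(ℝ, E) φ.symm x) := by
    rw [chartMul_chartOne_right hx]
    exact ((contMDiffAt_extChartAt_one_symm hx).mdifferentiableAt (by simp)).hasMFDerivAt
  have h2 := hs.comp (chartOne E G) hm
  -- Left translation in coordinates: both sides are differentiated at the unit, where the inverse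
  -- chart has identity derivative.
  have hev : (fun y : E => φ.symm x * φ.symm y) =ᶠ[𝓝 (chartOne E G)]
      fun y => φ.symm (chartMul E G (x, y)) := by
    have hcont : ContinuousAt (fun y : E => φ.symm x * φ.symm y) (chartOne E G) :=
      h1.continuousAt
    have hsrc : φ.source ∈ 𝓝 (φ.symm x * φ.symm (chartOne E G)) := by
      have : φ.symm (chartOne E G) = 1 := extChartAt_symm_chartOne (E := E)
      rw [this, mul_one]
      exact (isOpen_extChartAt_source 1).mem_nhds (φ.map_target hx)
    filter_upwards [hcont.preimage_mem_nhds hsrc] with y hy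
    exact (φ.left_inv hy).symm
  have h12 := hasMFDerivAt_unique h1 (h2.congr_of_eventuallyEq hev)
  have happ : mfderiv 𝓘(ℝ, E) 𝓘(ℝ, E) φ.symm x
      (fderiv ℝ (chartMul E G) (x, chartOne E G) ((0, Y) : E × E)) =
      mulInvariantVectorField Y (φ.symm x) := congr($h12 Y).symm
  rw [VectorField.mpullbackWithin_apply, ← happ]
  rw [mfderivWithin_univ] at hinv ⊢
  exact hinv.inverse_apply_eq.2 rfl

end LieGroupCharts

/-! ### Tangent spaces of coadjoint orbits -/

section CoadjointTangent

variable {E : Type*} [NormedAddCommGroup E] [NormedSpace ℝ E]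
  {G : Type*} [Group G] [TopologicalSpace G] [ChartedSpace E G] [LieGroup 𝓘(ℝ, E) ∞ G]

/-- The bracket of invariant fields is computed by pulling them back to the chart. No correction
factor appears, since the chart has identity derivative at its base point. -/
theorem groupLieAlgebra_lie_eq_lieBracket (X Y : GroupLieAlgebra 𝓘(ℝ, E) G) :
    ⁅X, Y⁆ = VectorField.lieBracket ℝ
      (fun x => fderiv ℝ (chartMul E G) (x, chartOne E G) ((0, X) : E × E))
      (fun x => fderiv ℝ (chartMul E G) (x, chartOne E G) ((0, Y) : E × E)) (chartOne E G) := by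
  rw [GroupLieAlgebra.bracket_def, ← VectorField.mlieBracketWithin_univ,
    VectorField.mlieBracketWithin_apply]
  have hid : ∀ A : E →L[ℝ] E, A = .id ℝ E → ∀ v, A.inverse v = v := fun A hA v => by
    rw [hA, ContinuousLinearMap.inverse_id, ContinuousLinearMap.id_apply]
  refine (hid _ mfderiv_extChartAt_self _).trans ?_
  simp only [modelWithCornersSelf_coe, Set.range_id, Set.preimage_univ, Set.inter_univ]
  refine (congrFun VectorField.lieBracketWithin_univ _).trans ?_
  refine Filter.EventuallyEq.lieBracket_vectorField_eq ?_ ?_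
  · filter_upwards [target_mem_nhds (G := G) chartOne_mem_target] with x hx
    exact mpullbackWithin_mulInvariantVectorField hx X
  · filter_upwards [target_mem_nhds (G := G) chartOne_mem_target] with x hx
    exact mpullbackWithin_mulInvariantVectorField hx Y

variable [CompleteSpace E]

variable (E G) in
/-- The map `x ↦ Ad(g⁻¹)`, where `x` is the coordinate of `g` in the chart at the identity. -/
noncomputable def chartAdjointInv (x : E) : E →L[ℝ] E :=
  adjointRep ((extChartAt 𝓘(ℝ, E) (1 : G)).symm x)⁻¹

/-- `Ad g⁻¹` solves the equation for `a` in `fderiv_eq_neg_lieBracket_of_comp_eq`, so its derivative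
at the identity is `-ad`. -/
theorem differentiableAt_chartAdjointInv_and_fderiv :
    DifferentiableAt ℝ (chartAdjointInv E G) (chartOne E G) ∧
      ∀ X Y : GroupLieAlgebra 𝓘(ℝ, E) G,
        fderiv ℝ (chartAdjointInv E G) (chartOne E G) X Y = -⁅X, Y⁆ := by
  have h := fderiv_eq_neg_lieBracket_of_comp_eq (m := chartMul E G) (x₀ := chartOne E G)
    (a := chartAdjointInv E G)
    ((contDiffAt_chartMul_chartOne_right chartOne_mem_target).of_le (WithTop.coe_le_coe.2 le_top))
    fderiv_chartMul_comp_inl_chartOne fderiv_chartMul_comp_inr_chartOne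
    (by
      filter_upwards [target_mem_nhds (G := G) chartOne_mem_target] with x hx
      exact fderiv_chartMul_comp_adjointRep_inv hx)
  refine ⟨h.1, fun X Y => ?_⟩
  rw [groupLieAlgebra_lie_eq_lieBracket]
  exact h.2 X Y

variable (G) in
/-- The differential at the identity of the orbit map `g ↦ K_g F`. -/
noncomputable def coadjointOrbitDeriv (F : StrongDual ℝ E) : E →L[ℝ] StrongDual ℝ E :=
  mfderiv 𝓘(ℝ, E) 𝓘(ℝ, StrongDual ℝ E) (fun g : G => coadjointRep g F) (1 : G)

variable (G) in
/-- The bracket of the Lie algebra of `G`, on the model space. -/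
noncomputable def modelBracket (X Y : E) : E :=
  Bracket.bracket (L := GroupLieAlgebra 𝓘(ℝ, E) G) (M := GroupLieAlgebra 𝓘(ℝ, E) G) X Y

/-- The differential at the identity of the orbit map `g ↦ K_g F` is `X ↦ -F([X, ·])`. -/
theorem coadjointOrbitDeriv_apply (F : StrongDual ℝ E) (X Y : E) :
    coadjointOrbitDeriv G F X Y = -F (modelBracket G X Y) := by
  obtain ⟨hd, hf⟩ := differentiableAt_chartAdjointInv_and_fderiv (E := E) (G := G)
  set φ := extChartAt 𝓘(ℝ, E) (1 : G)
  have h1 : HasFDerivAt (fun x => F.comp (chartAdjointInv E G x))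
      ((ContinuousLinearMap.compL ℝ E E ℝ F) ∘L fderiv ℝ (chartAdjointInv E G) (chartOne E G))
      (φ 1) :=
    ((ContinuousLinearMap.compL ℝ E E ℝ F).hasFDerivAt).comp _ hd.hasFDerivAt
  have h2 : HasMFDerivAt 𝓘(ℝ, E) 𝓘(ℝ, E) φ (1 : G) (.id ℝ E) := by
    have h := (mdifferentiableAt_extChartAt (I := 𝓘(ℝ, E)) (mem_chart_source E (1 : G))).hasMFDerivAt
    rwa [mfderiv_extChartAt_self] at h
  have h3 := h1.hasMFDerivAt.comp (1 : G) h2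
  have hev : (fun g : G => coadjointRep g F) =ᶠ[𝓝 1]
      (fun x => F.comp (chartAdjointInv E G x)) ∘ φ := by
    filter_upwards [extChartAt_source_mem_nhds (I := 𝓘(ℝ, E)) (1 : G)] with g hg
    simp only [coadjointRep, Function.comp_apply, chartAdjointInv]
    rw [φ.left_inv hg]
  rw [coadjointOrbitDeriv, (h3.congr_of_eventuallyEq hev).mfderiv]
  change F (fderiv ℝ (chartAdjointInv E G) (chartOne E G) X Y) = _
  rw [← map_neg]
  exact congrArg F (hf X Y)

end CoadjointTangent

/-! ### From orbit dimensions to ranks of Kirillov forms -/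

/-- The form `(x, y) ↦ F([x, y])` attached to a linear form on a Lie algebra. -/
noncomputable def kirillovForm {L : Type*} [LieRing L] [LieAlgebra ℝ L] (F : Module.Dual ℝ L) :
    L →ₗ[ℝ] Module.Dual ℝ L :=
  LinearMap.mk₂ ℝ (fun x y => F ⁅x, y⁆) (by simp) (by simp) (by simp) (by simp)

@[simp] theorem kirillovForm_apply {L : Type*} [LieRing L] [LieAlgebra ℝ L] (F : Module.Dual ℝ L)
    (x y : L) : kirillovForm F x y = F ⁅x, y⁆ := rfl

/-- The infinitesimal form of the MD condition: the non-zero Kirillov forms have rank `k`. -/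
theorem IsMDAlgebra.finrank_range_kirillovForm {k n : ℕ} {L : Type u} [LieRing L]
    [LieAlgebra ℝ L] (hL : IsMDAlgebra.{u, v} k n L) (F : Module.Dual ℝ L)
    (hF : kirillovForm F ≠ 0) : Module.finrank ℝ (LinearMap.range (kirillovForm F)) = k := by
  obtain ⟨G, _, _, _, _, hG, ⟨e⟩⟩ := hL
  set E := EuclideanSpace ℝ (Fin n)
  let e' : E ≃ₗ[ℝ] L := e.toLinearEquiv
  let f : StrongDual ℝ E := LinearMap.toContinuousLinearMap (F ∘ₗ e'.toLinearMap)
  set D : E →L[ℝ] StrongDual ℝ E := coadjointOrbitDeriv G f with hDdef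
  have hD : ∀ X Y : E, D X Y = -kirillovForm F (e' X) (e' Y) := fun X Y => by
    have h2 : e' (modelBracket G X Y) = ⁅e' X, e' Y⁆ := e.map_lie _ _
    rw [hDdef, coadjointOrbitDeriv_apply, kirillovForm_apply, ← h2]
    rfl
  have hD0 : D ≠ 0 := fun h => hF <| by
    ext x y
    have := hD (e'.symm x) (e'.symm y)
    simpa [h] using this
  -- A one-point orbit would make the orbit map constant, hence its differential `D` zero.
  have horb : (coadjointOrbit G f).Nontrivial := by
    by_contra hnt
    rw [Set.not_nontrivial_iff] at hnt
    apply hD0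
    have : (fun g : G => coadjointRep g f) = fun _ => coadjointRep (1 : G) f :=
      funext fun g => hnt ⟨g, rfl⟩ ⟨1, rfl⟩
    rw [hDdef, coadjointOrbitDeriv, this]
    exact mfderiv_const
  have hk := hG.orbit_dim f horb
  let T : StrongDual ℝ E ≃ₗ[ℝ] Module.Dual ℝ L :=
    (LinearMap.toContinuousLinearMap (𝕜 := ℝ) (E := E) (F' := ℝ)).symm ≪≫ₗ e'.symm.dualMap
  have hrange : kirillovForm F ∘ₗ e'.toLinearMap = -(T.toLinearMap ∘ₗ D.toLinearMap) := by
    ext X y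
    have h : D X (e'.symm y) = -kirillovForm F (e' X) y := by rw [hD, e'.apply_symm_apply]
    change kirillovForm F (e' X) y = -D X (e'.symm y)
    rw [h, neg_neg]
  rw [← LinearMap.range_comp_of_range_eq_top (kirillovForm F) e'.range, hrange,
    LinearMap.range_neg, LinearMap.range_comp]
  exact (LinearEquiv.finrank_map_eq T _).trans hk

/-! ### Isotropic subspaces and hyperbolic systems -/

section LinearAlgebra

variable {V W W' : Type*} [AddCommGroup V] [Module ℝ V]
  [AddCommGroup W] [Module ℝ W] [AddCommGroup W'] [Module ℝ W']

theorem finrank_range_le_of_ker_le [FiniteDimensional ℝ V]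
    {f : V →ₗ[ℝ] W} {g : V →ₗ[ℝ] W'}
    (h : LinearMap.ker f ≤ LinearMap.ker g) :
    Module.finrank ℝ (LinearMap.range g) ≤ Module.finrank ℝ (LinearMap.range f) := by
  have h1 := f.finrank_range_add_finrank_ker
  have h2 := g.finrank_range_add_finrank_ker
  have h3 := Submodule.finrank_mono h
  omega

/-- A form vanishing on a subspace of codimension `c` has rank at most `2c`. -/
theorem finrank_range_add_two_mul_finrank_le_of_isotropic [FiniteDimensional ℝ V]
    (B : V →ₗ[ℝ] Module.Dual ℝ V)
    (U : Submodule ℝ V) (hU : ∀ x ∈ U, ∀ y ∈ U, B x y = 0) :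
    Module.finrank ℝ (LinearMap.range B) + 2 * Module.finrank ℝ U ≤
      2 * Module.finrank ℝ V := by
  have h1 := B.finrank_range_add_finrank_ker
  have h2 := (B.domRestrict U).finrank_range_add_finrank_ker
  -- Isotropy sends `U` into its annihilator, whence `dim U ≤ codim U + dim (ker B)`.
  have h3 : Module.finrank ℝ (LinearMap.range (B.domRestrict U)) ≤
      Module.finrank ℝ U.dualAnnihilator := by
    refine Submodule.finrank_mono ?_
    rintro _ ⟨x, rfl⟩
    exact (Submodule.mem_dualAnnihilator _).2 fun y hy => hU x x.2 y hy
  have h4 := Subspace.finrank_add_finrank_dualAnnihilator_eq U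
  have h5 : Module.finrank ℝ (LinearMap.ker (B.domRestrict U)) ≤
      Module.finrank ℝ (LinearMap.ker B) := by
    rw [LinearEquiv.finrank_eq
      (Submodule.equivMapOfInjective U.subtype U.injective_subtype (LinearMap.ker (B.domRestrict U)))]
    refine Submodule.finrank_mono ?_
    rintro _ ⟨x, hx, rfl⟩
    exact hx
  omega

/-- Two families of `m` vectors spanning a hyperbolic subspace of dimension `2m`. -/
structure IsHyperbolicSystem (B : V →ₗ[ℝ] Module.Dual ℝ V) {m : ℕ} (u v : Fin m → V) : Prop where
  left : ∀ i j, B (u i) (u j) = 0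
  right : ∀ i j, B (v i) (v j) = 0
  pair : ∀ i j, B (u i) (v j) = if i = j then 1 else 0

namespace IsHyperbolicSystem

variable {B : V →ₗ[ℝ] Module.Dual ℝ V} {m : ℕ} {u v : Fin m → V}

theorem pair' (h : IsHyperbolicSystem B u v) (hB : B.IsAlt) (i j : Fin m) :
    B (v i) (u j) = if i = j then -1 else 0 := by
  rw [← hB.neg, h.pair]
  split_ifs with h1 h2 h2 <;> simp_all

/-- The coordinates of a vector along a hyperbolic system. -/
noncomputable def coord (B : V →ₗ[ℝ] Module.Dual ℝ V) (u v : Fin m → V) :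
    V →ₗ[ℝ] (Fin m → ℝ) × (Fin m → ℝ) :=
  (LinearMap.pi fun i => -(B (v i))).prod (LinearMap.pi fun i => B (u i))

/-- The vector with prescribed coordinates along a hyperbolic system. -/
noncomputable def comb (u v : Fin m → V) : (Fin m → ℝ) × (Fin m → ℝ) →ₗ[ℝ] V :=
  (Fintype.linearCombination ℝ u).coprod (Fintype.linearCombination ℝ v)

theorem coord_comb (h : IsHyperbolicSystem B u v) (hB : B.IsAlt) (p) :
    coord B u v (comb u v p) = p := by
  ext i <;> simp [coord, comb, Fintype.linearCombination_apply, h.left, h.right, h.pair,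
    h.pair' hB]

theorem apply_comb (h : IsHyperbolicSystem B u v) (hB : B.IsAlt) (p q) :
    B (comb u v p) (comb u v q) = ∑ i, (p.1 i * q.2 i - q.1 i * p.2 i) := by
  have h1 : ∀ i, B (comb u v p) (v i) = p.1 i := fun i => by
    rw [← hB.neg]
    exact congrFun (congrArg Prod.fst (h.coord_comb hB p)) i
  have h2 : ∀ i, B (comb u v p) (u i) = -p.2 i := fun i => by
    rw [← hB.neg]
    exact congrArg Neg.neg (congrFun (congrArg Prod.snd (h.coord_comb hB p)) i)
  have h3 : B (comb u v p) (comb u v q) = ∑ i, q.1 i * -p.2 i + ∑ i, q.2 i * p.1 i := by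
    generalize comb u v p = a at h1 h2
    simp [comb, Fintype.linearCombination_apply, h1, h2]
  rw [h3, ← Finset.sum_add_distrib]
  exact Finset.sum_congr rfl fun i _ => by ring

theorem le_finrank [FiniteDimensional ℝ V] (h : IsHyperbolicSystem B u v) (hB : B.IsAlt) : m ≤ Module.finrank ℝ V := by
  have := LinearMap.finrank_le_finrank_of_injective
    (f := comb u v) (Function.LeftInverse.injective (h.coord_comb hB))
  simp at this
  omega

/-- Subtracting from `y` its component along the system leaves its pairing with `w` unchanged,
because `w` is orthogonal to the system. After rescaling, it is a partner for `w`. -/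
theorem extend (h : IsHyperbolicSystem B u v) (hB : B.IsAlt) {w y : V}
    (hw : coord B u v w = 0) (hy : B w y ≠ 0) :
    ∃ u' v' : Fin (m + 1) → V, IsHyperbolicSystem B u' v' := by
  set y' := (B w y)⁻¹ • (y - comb u v (coord B u v y)) with hy'
  have hc : coord B u v y' = 0 := by simp [hy', h.coord_comb hB]
  have hzero : ∀ {a}, coord B u v a = 0 → ∀ i, B (u i) a = 0 ∧ B (v i) a = 0 := fun ha i => by
    have h1 := congrFun (congrArg Prod.fst ha) i
    have h2 := congrFun (congrArg Prod.snd ha) i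
    simp [coord] at h1 h2
    exact ⟨h2, h1⟩
  have hzero' : ∀ {a}, coord B u v a = 0 → ∀ i, B a (u i) = 0 ∧ B a (v i) = 0 := fun ha i => by
    exact ⟨by rw [← hB.neg, (hzero ha i).1, neg_zero], by rw [← hB.neg, (hzero ha i).2, neg_zero]⟩
  have hpair : B w y' = 1 := by
    have : B w (comb u v (coord B u v y)) = 0 := by
      simp [comb, Fintype.linearCombination_apply, hzero' hw]
    simp [hy', this, hy]
  refine ⟨Fin.cons w u, Fin.cons y' v, ⟨?_, ?_, ?_⟩⟩
  · intro i j
    refine Fin.cases ?_ (fun i => ?_) i <;> refine Fin.cases ?_ (fun j => ?_) j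
    · simpa using hB.self_eq_zero w
    · simpa using (hzero' hw j).1
    · simpa using (hzero hw i).1
    · simpa using h.left i j
  · intro i j
    refine Fin.cases ?_ (fun i => ?_) i <;> refine Fin.cases ?_ (fun j => ?_) j
    · simpa using hB.self_eq_zero y'
    · simpa using (hzero' hc j).2
    · simpa using (hzero hc i).2
    · simpa using h.right i j
  · intro i j
    refine Fin.cases ?_ (fun i => ?_) i <;> refine Fin.cases ?_ (fun j => ?_) j
    · simpa using hpair
    · simpa [(Fin.succ_ne_zero j).symm] using (hzero' hw j).2
    · simpa [Fin.succ_ne_zero i] using (hzero hc i).1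
    · simpa using h.pair i j

/-- Every alternating form is the sum of a hyperbolic form and of a zero form. -/
theorem exists_ker_coord_le [FiniteDimensional ℝ V] (hB : B.IsAlt) :
    ∃ (m : ℕ) (u v : Fin m → V), IsHyperbolicSystem B u v ∧
      LinearMap.ker (coord B u v) ≤ LinearMap.ker B := by
  classical
  let P : ℕ → Prop := fun m => ∃ u v : Fin m → V, IsHyperbolicSystem B u v
  have hP0 : P 0 := ⟨Fin.elim0, Fin.elim0, ⟨fun i => i.elim0, fun i => i.elim0, fun i => i.elim0⟩⟩
  -- A system of maximal size is taken; a vector orthogonal to it but outside the radical would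
  -- enlarge it.
  have hP := Nat.findGreatest_spec (P := P) (Nat.zero_le (Module.finrank ℝ V)) hP0
  set m := Nat.findGreatest P (Module.finrank ℝ V) with hm
  obtain ⟨u, v, h⟩ := hP
  refine ⟨m, u, v, h, fun w hw => ?_⟩
  by_contra hne
  obtain ⟨y, hy⟩ : ∃ y, B w y ≠ 0 := by
    by_contra! hall
    exact hne (LinearMap.ext hall)
  obtain ⟨u', v', h'⟩ := h.extend hB hw hy
  have := Nat.le_findGreatest (P := P) (h'.le_finrank hB) ⟨u', v', h'⟩
  omega

/-- `B` and `coord` have the same kernel, and `coord` is onto a space of dimension `2 * m`. -/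
theorem finrank_range [FiniteDimensional ℝ V] (h : IsHyperbolicSystem B u v) (hB : B.IsAlt)
    (hker : LinearMap.ker (coord B u v) ≤ LinearMap.ker B) :
    Module.finrank ℝ (LinearMap.range B) = 2 * m := by
  have hrange : LinearMap.range (coord B u v) = ⊤ :=
    LinearMap.range_eq_top.2 (Function.RightInverse.surjective (h.coord_comb hB))
  have hfin : Module.finrank ℝ (LinearMap.range (coord B u v)) = 2 * m := by
    rw [hrange, finrank_top]; simp; omega
  have hker' : LinearMap.ker B ≤ LinearMap.ker (coord B u v) := fun w hw => by
    have hw' : ∀ y, B w y = 0 := fun y => congrArg (fun f => f y) (LinearMap.mem_ker.1 hw)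
    have : ∀ y, B y w = 0 := fun y => by rw [← hB.neg, hw', neg_zero]
    refine LinearMap.mem_ker.2 ?_
    ext i <;> simp [coord, this]
  have h1 := finrank_range_le_of_ker_le hker
  have h2 := finrank_range_le_of_ker_le hker'
  omega

end IsHyperbolicSystem

end LinearAlgebra

/-! ### The derived algebra and Kirillov forms -/

section DerivedAlgebra

variable {L : Type*} [LieRing L] [LieAlgebra ℝ L]

theorem lie_mem_derivedSeries_one (x y : L) : ⁅x, y⁆ ∈ LieAlgebra.derivedSeries ℝ L 1 :=
  LieSubmodule.lie_mem_lie (LieSubmodule.mem_top x) (LieSubmodule.mem_top y)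

theorem derivedSeries_one_induction {p : L → Prop} (h : ∀ x y : L, p ⁅x, y⁆)
    (h0 : p 0) (hadd : ∀ x y, p x → p y → p (x + y)) (hsmul : ∀ (c : ℝ) x, p x → p (c • x))
    {u : L} (hu : u ∈ LieAlgebra.derivedSeries ℝ L 1) : p u := by
  have hu' : u ∈ (⁅(⊤ : LieIdeal ℝ L), (⊤ : LieIdeal ℝ L)⁆ : LieIdeal ℝ L).toSubmodule := hu
  rw [LieSubmodule.lieIdeal_oper_eq_linear_span'] at hu'
  refine Submodule.span_induction ?_ h0 (fun x y _ _ => hadd x y) (fun c x _ => hsmul c x) hu'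
  rintro _ ⟨x, -, y, -, rfl⟩
  exact h x y

theorem isAlt_kirillovForm (F : Module.Dual ℝ L) : (kirillovForm F).IsAlt := fun x => by simp

/-- A form killing all brackets kills their span. -/
theorem kirillovForm_ne_zero {F : Module.Dual ℝ L} {u : L}
    (hu : u ∈ LieAlgebra.derivedSeries ℝ L 1) (hF : F u ≠ 0) : kirillovForm F ≠ 0 := fun h =>
  hF <| derivedSeries_one_induction (p := fun u => F u = 0)
    (fun x y => by rw [← kirillovForm_apply, h]; rfl) (map_zero F)
    (fun x y hx hy => by rw [map_add, hx, hy, add_zero])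
    (fun c x hx => by rw [map_smul, hx, smul_zero]) hu

end DerivedAlgebra

theorem IsMDAlgebra.finiteDimensional {k n : ℕ} {L : Type u} [LieRing L]
    [LieAlgebra ℝ L] (hL : IsMDAlgebra.{u, v} k n L) : FiniteDimensional ℝ L := by
  obtain ⟨G, _, _, _, _, -, ⟨e⟩⟩ := hL
  let e' : EuclideanSpace ℝ (Fin n) ≃ₗ[ℝ] L := e.toLinearEquiv
  exact e'.finiteDimensional

theorem IsMDAlgebra.finrank_eq {k n : ℕ} {L : Type u} [LieRing L]
    [LieAlgebra ℝ L] (hL : IsMDAlgebra.{u, v} k n L) : Module.finrank ℝ L = n := by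
  obtain ⟨G, _, _, _, _, -, ⟨e⟩⟩ := hL
  let e' : EuclideanSpace ℝ (Fin n) ≃ₗ[ℝ] L := e.toLinearEquiv
  rw [← e'.finrank_eq, finrank_euclideanSpace_fin]

namespace HeisenbergAlgebra

/-- The coordinates of the Heisenberg algebra, as a linear map. -/
noncomputable def linearEquivProd (m : ℕ) :
    HeisenbergAlgebra m ≃ₗ[ℝ] (Fin m → ℝ) × (Fin m → ℝ) × ℝ :=
  { equivProd m with
    map_add' := fun _ _ => rfl
    map_smul' := fun _ _ => rfl }

end HeisenbergAlgebra

/-- The underlying vector space of the abelian algebra. -/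
noncomputable def AbelianAlgebra.linearEquivPi (k : ℕ) : AbelianAlgebra k ≃ₗ[ℝ] (Fin k → ℝ) :=
  LinearEquiv.refl ℝ (Fin k → ℝ)

/-! ### One-dimensional derived algebra -/

section Heisenberg

variable {L : Type*} [LieRing L] [LieAlgebra ℝ L] [FiniteDimensional ℝ L]

theorem exists_lie_eq_of_finrank_derivedSeries_eq_one
    (h : Module.finrank ℝ (LieAlgebra.derivedSeries ℝ L 1) = 1) :
    ∃ (F : Module.Dual ℝ L) (z : L), F z = 1 ∧ z ∈ LieAlgebra.derivedSeries ℝ L 1 ∧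
      ∀ x y : L, ⁅x, y⁆ = F ⁅x, y⁆ • z := by
  obtain ⟨⟨z, hz⟩, hz0, hspan⟩ := finrank_eq_one_iff'.1 h
  have hz0' : z ≠ 0 := fun h => hz0 (Subtype.ext h)
  obtain ⟨F, hF⟩ := Module.Projective.exists_dual_eq_one ℝ hz0'
  refine ⟨F, z, hF, hz, fun x y => ?_⟩
  obtain ⟨c, hc⟩ := hspan ⟨⁅x, y⁆, lie_mem_derivedSeries_one x y⟩
  have hc' : c • z = ⁅x, y⁆ := congrArg Subtype.val hc
  rw [← hc', map_smul, hF, smul_eq_mul, mul_one]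

/-- Suppose `F ⁅x, z⁆ ≠ 0`. For `y` orthogonal to `x` and `z`, the Jacobi identity for `x, y, w`
reduces to `F ⁅y, w⁆ * F ⁅x, z⁆ = 0`. The radical then has codimension at most 2. -/
theorem kirillovForm_eq_zero_of_lie_eq {F : Module.Dual ℝ L} {z : L}
    (hFz : ∀ x y : L, ⁅x, y⁆ = F ⁅x, y⁆ • z)
    (hrank : 2 < Module.finrank ℝ (LinearMap.range (kirillovForm F))) :
    kirillovForm F z = 0 := by
  by_contra hz
  obtain ⟨x, hx⟩ : ∃ x, F ⁅x, z⁆ ≠ 0 := by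
    by_contra! hall
    refine hz (LinearMap.ext fun x => ?_)
    rw [kirillovForm_apply, ← lie_skew, map_neg, hall, neg_zero, LinearMap.zero_apply]
  have hker : LinearMap.ker ((kirillovForm F x).prod (kirillovForm F z)) ≤
      LinearMap.ker (kirillovForm F) := by
    intro y hy
    have hxy : F ⁅x, y⁆ = 0 := congrArg Prod.fst (LinearMap.mem_ker.1 hy)
    have hzy : F ⁅z, y⁆ = 0 := congrArg Prod.snd (LinearMap.mem_ker.1 hy)
    have hyz : F ⁅y, z⁆ = 0 := by rw [← lie_skew, map_neg, hzy, neg_zero]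
    refine LinearMap.mem_ker.2 (LinearMap.ext fun w => ?_)
    have hj := congrArg F (leibniz_lie x y w)
    rw [hFz x y, hxy, zero_smul, zero_lie, zero_add, hFz y w, lie_smul, hFz x w, lie_smul,
      map_smul, map_smul, hyz] at hj
    simpa [hx] using hj
  have h1 := finrank_range_le_of_ker_le hker
  have h2 := Submodule.finrank_le (LinearMap.range ((kirillovForm F x).prod (kirillovForm F z)))
  simp at h2
  omega

-- A maximal hyperbolic system supplies the `x_i` and `y_i`. The radical is a plane, and it is
-- central because brackets are determined by `F`; `z` and a complementary vector `t` span it.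
open IsHyperbolicSystem in
theorem exists_lieEquiv_heisenberg {F : Module.Dual ℝ L} {z : L} (hF : F z = 1)
    (hFz : ∀ x y : L, ⁅x, y⁆ = F ⁅x, y⁆ • z) (hz : kirillovForm F z = 0)
    (hrank : Module.finrank ℝ (LinearMap.range (kirillovForm F)) + 2 = Module.finrank ℝ L) :
    ∃ m : ℕ, Module.finrank ℝ L = 2 * m + 2 ∧
      Nonempty (L ≃ₗ⁅ℝ⁆ HeisenbergAlgebra m × AbelianAlgebra 1) := by
  have hB := isAlt_kirillovForm F
  obtain ⟨m, u, v, huv, hker⟩ := exists_ker_coord_le hB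
  have hm := huv.finrank_range hB hker
  have hdim := (kirillovForm F).finrank_range_add_finrank_ker
  refine ⟨m, by omega, ?_⟩
  obtain ⟨t, ht, htz⟩ : ∃ t ∈ LinearMap.ker (kirillovForm F), t ∉ Submodule.span ℝ {z} := by
    by_contra! hall
    have h1 := Submodule.finrank_mono (show LinearMap.ker (kirillovForm F) ≤ _ from hall)
    have h2 := finrank_span_le_card (R := ℝ) ({z} : Set L)
    simp at h2
    omega
  let f : HeisenbergAlgebra m × AbelianAlgebra 1 →ₗ[ℝ] L :=
    { toFun := fun p => comb u v (p.1.x, p.1.y) + p.1.z • z + p.2 0 • t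
      map_add' := fun p q => by
        have h1 : ((p + q).1.x, (p + q).1.y) = (p.1.x, p.1.y) + (q.1.x, q.1.y) := rfl
        have h2 : (p + q).1.z = p.1.z + q.1.z := rfl
        have h3 : (p + q).2 0 = p.2 0 + q.2 0 := rfl
        rw [h1, h2, h3, map_add, add_smul, add_smul]
        abel
      map_smul' := fun c p => by
        have h1 : ((c • p).1.x, (c • p).1.y) = c • (p.1.x, p.1.y) := rfl
        have h2 : (c • p).1.z = c * p.1.z := rfl
        have h3 : (c • p).2 0 = c * p.2 0 := rfl
        rw [h1, h2, h3, map_smul, mul_smul, mul_smul, RingHom.id_apply, smul_add, smul_add] }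
  have hzero : ∀ {a}, kirillovForm F a = 0 → coord (kirillovForm F) u v a = 0 := fun {a} ha => by
    have h' : ∀ y, F ⁅a, y⁆ = 0 := fun y => congrArg (fun f => f y) ha
    have : ∀ y, F ⁅y, a⁆ = 0 := fun y => by rw [← lie_skew, map_neg, h', neg_zero]
    ext i <;> simp [coord, this]
  have hcoord : ∀ p, coord (kirillovForm F) u v (f p) = (p.1.x, p.1.y) := fun p => by
    simp [f, huv.coord_comb hB, hzero hz, hzero (LinearMap.mem_ker.1 ht)]
  have hinj : Function.Injective f := by
    rw [← LinearMap.ker_eq_bot, LinearMap.ker_eq_bot']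
    intro p hp
    have hxy : (p.1.x, p.1.y) = 0 := by rw [← hcoord p, hp, map_zero]
    have hp' : p.1.z • z + p.2 0 • t = 0 := by
      have : comb u v (p.1.x, p.1.y) + p.1.z • z + p.2 0 • t = 0 := hp
      rwa [hxy, map_zero, zero_add] at this
    have h2 : p.2 0 = 0 := by
      by_contra hne
      refine htz (Submodule.mem_span_singleton.2 ⟨-((p.2 0)⁻¹ * p.1.z), ?_⟩)
      have : t = (p.2 0)⁻¹ • (p.2 0 • t) := by rw [smul_smul, inv_mul_cancel₀ hne, one_smul]
      rw [this, ← neg_eq_of_add_eq_zero_right hp', smul_neg, smul_smul, neg_smul]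
    have hz0 : z ≠ 0 := fun h => by simp [h] at hF
    have h1 : p.1.z = 0 := by simpa [h2, hz0] using hp'
    refine Prod.ext (HeisenbergAlgebra.ext ?_ ?_ h1) (funext fun i => ?_)
    · exact congrArg Prod.fst hxy
    · exact congrArg Prod.snd hxy
    · rw [Subsingleton.elim i 0]; exact h2
  have hfin : Module.finrank ℝ (HeisenbergAlgebra m × AbelianAlgebra 1) = Module.finrank ℝ L := by
    rw [((HeisenbergAlgebra.linearEquivProd m).prodCongr
      (AbelianAlgebra.linearEquivPi 1)).finrank_eq]
    simp
    omega
  have : FiniteDimensional ℝ (HeisenbergAlgebra m × AbelianAlgebra 1) :=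
    ((HeisenbergAlgebra.linearEquivProd m).prodCongr
      (AbelianAlgebra.linearEquivPi 1)).symm.finiteDimensional
  let g := LinearEquiv.ofInjectiveOfFinrankEq f hinj hfin
  have hlie : ∀ p q, f ⁅p, q⁆ = ⁅f p, f q⁆ := fun p q => by
    have hz' : ∀ y, kirillovForm F y z = 0 := fun y => by rw [← hB.neg, hz]; simp
    have ht0 : kirillovForm F t = 0 := LinearMap.mem_ker.1 ht
    have ht' : ∀ y, kirillovForm F y t = 0 := fun y => by rw [← hB.neg, ht0]; simp
    have hfpq : F ⁅f p, f q⁆ = ⁅p, q⁆.1.z := by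
      have h1 : F ⁅f p, f q⁆ =
          kirillovForm F (comb u v (p.1.x, p.1.y)) (comb u v (q.1.x, q.1.y)) := by
        rw [← kirillovForm_apply]
        simp only [f, LinearMap.coe_mk, AddHom.coe_mk, map_add, map_smul, hz, ht0,
          hz', ht', smul_zero, add_zero]
      rw [h1, huv.apply_comb hB]
      rfl
    have h0 : f ⁅p, q⁆ = comb u v 0 + ⁅p, q⁆.1.z • z + (0 : ℝ) • t := rfl
    rw [hFz (f p) (f q), hfpq, h0, map_zero, zero_smul, zero_add, add_zero]
  exact ⟨LieEquiv.symm { g with map_lie' := fun {p q} => hlie p q }⟩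

end Heisenberg

/-! ### Recognising the complex affine algebra -/

section AffineComplex

namespace AffineAlgebraComplex

/-- The coordinates of `aff(ℂ)`, as a linear map. -/
noncomputable def linearEquivProd : AffineAlgebraComplex ≃ₗ[ℝ] ℂ × ℂ :=
  { equivProd with
    map_add' := fun _ _ => rfl
    map_smul' := fun _ _ => rfl }

end AffineAlgebraComplex

variable {L : Type*} [LieRing L] [LieAlgebra ℝ L]

/-- Here `w₁`, `w₂` play the roles of `1`, `i` acting by multiplication on the plane with basis `v₁
= 1`, `v₂ = i`. -/
theorem nonempty_lieEquiv_affineAlgebraComplex [FiniteDimensional ℝ L]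
    (hdim : Module.finrank ℝ L = 6) {w₁ w₂ v₁ v₂ : L} {z : Fin 2 → L}
    (hw : ⁅w₁, w₂⁆ = 0) (h11 : ⁅w₁, v₁⁆ = v₁) (h12 : ⁅w₁, v₂⁆ = v₂) (h21 : ⁅w₂, v₁⁆ = v₂)
    (h22 : ⁅w₂, v₂⁆ = -v₁) (hv : ⁅v₁, v₂⁆ = 0) (hv0 : v₁ ≠ 0)
    (hz : ∀ i (x : L), ⁅x, z i⁆ = 0) (hzind : LinearIndependent ℝ z) :
    Nonempty (L ≃ₗ⁅ℝ⁆ AffineAlgebraComplex × AbelianAlgebra 2) := by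
  have hind : ∀ a b : ℝ, a • v₁ + b • v₂ = 0 → a = 0 ∧ b = 0 := fun a b h => by
    have h' := congrArg (fun x => ⁅w₂, x⁆) h
    simp only [lie_add, lie_smul, h21, h22, lie_zero] at h'
    -- This applies the conjugate `a - b * ad w₂` to the relation `(a + b * ad w₂) v₁ = 0`.
    have h3 : (a * a + b * b) • v₁ = 0 := by
      have : (a * a + b * b) • v₁ = a • (a • v₁ + b • v₂) - b • (a • v₂ + b • -v₁) := by module
      rw [this, h, h', smul_zero, smul_zero, sub_zero]
    have h4 := (smul_eq_zero.1 h3).resolve_right hv0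
    constructor <;> nlinarith [mul_self_nonneg a, mul_self_nonneg b]
  have hz' : ∀ i (x : L), ⁅z i, x⁆ = 0 := fun i x => by rw [← lie_skew, hz, neg_zero]
  have hw' : ⁅w₂, w₁⁆ = 0 := by rw [← lie_skew, hw, neg_zero]
  have h11' : ⁅v₁, w₁⁆ = -v₁ := by rw [← lie_skew, h11]
  have h12' : ⁅v₂, w₁⁆ = -v₂ := by rw [← lie_skew, h12]
  have h21' : ⁅v₁, w₂⁆ = -v₂ := by rw [← lie_skew, h21]
  have h22' : ⁅v₂, w₂⁆ = v₁ := by rw [← lie_skew, h22, neg_neg]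
  have hv' : ⁅v₂, v₁⁆ = 0 := by rw [← lie_skew, hv, neg_zero]
  let f : AffineAlgebraComplex × AbelianAlgebra 2 →ₗ[ℝ] L :=
    { toFun := fun p => p.1.a.re • w₁ + p.1.a.im • w₂ + p.1.b.re • v₁ + p.1.b.im • v₂ +
        p.2 0 • z 0 + p.2 1 • z 1
      map_add' := fun p q => by
        have h : ∀ i, (p + q).2 i = p.2 i + q.2 i := fun i => rfl
        simp only [Prod.fst_add, AffineAlgebraComplex.a_add, AffineAlgebraComplex.b_add,
          Complex.add_re, Complex.add_im, h]
        module
      map_smul' := fun c p => by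
        have h : ∀ i, (c • p).2 i = c * p.2 i := fun i => rfl
        simp only [Prod.smul_fst, AffineAlgebraComplex.a_smul, AffineAlgebraComplex.b_smul,
          Complex.smul_re, Complex.smul_im, h, smul_eq_mul, RingHom.id_apply]
        module }
  have hf : ∀ p, f p = p.1.a.re • w₁ + p.1.a.im • w₂ + p.1.b.re • v₁ + p.1.b.im • v₂ +
        p.2 0 • z 0 + p.2 1 • z 1 := fun p => rfl
  have hinj : Function.Injective f := by
    rw [← LinearMap.ker_eq_bot, LinearMap.ker_eq_bot']
    intro p hp
    -- Bracketing with `v₁` isolates the `a` coordinates, and bracketing with `w₁` isolates the `b`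
    -- coordinates.
    have ha := congrArg (fun x => ⁅x, v₁⁆) hp
    simp only [hf, add_lie, smul_lie, h11, h21, lie_self, hv', hz', smul_zero, add_zero,
      zero_lie] at ha
    obtain ⟨ha1, ha2⟩ := hind _ _ ha
    have hb := congrArg (fun x => ⁅w₁, x⁆) hp
    simp only [hf, ha1, ha2, lie_add, lie_smul, h11, h12, hz, zero_smul, smul_zero, add_zero,
      zero_add, lie_zero] at hb
    obtain ⟨hb1, hb2⟩ := hind _ _ hb
    simp only [hf, ha1, ha2, hb1, hb2, zero_smul, zero_add] at hp
    have hp' := Fintype.linearIndependent_iff.1 hzind p.2 (by rw [Fin.sum_univ_two]; exact hp)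
    exact Prod.ext (AffineAlgebraComplex.ext (Complex.ext ha1 ha2) (Complex.ext hb1 hb2))
      (funext hp')
  let c := AffineAlgebraComplex.linearEquivProd.prodCongr (AbelianAlgebra.linearEquivPi 2)
  have : FiniteDimensional ℝ (AffineAlgebraComplex × AbelianAlgebra 2) := c.symm.finiteDimensional
  have hfin : Module.finrank ℝ (AffineAlgebraComplex × AbelianAlgebra 2) =
      Module.finrank ℝ L := by
    rw [c.finrank_eq, hdim]
    simp
  have hlie : ∀ p q, f ⁅p, q⁆ = ⁅f p, f q⁆ := fun p q => by
    have h2 : ∀ i, ⁅p, q⁆.2 i = 0 := fun i => rfl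
    have h1 : ⁅p, q⁆.1 = ⁅p.1, q.1⁆ := rfl
    simp only [hf, h2, h1, AffineAlgebraComplex.a_lie, AffineAlgebraComplex.b_lie,
      Complex.sub_re, Complex.sub_im, Complex.mul_re, Complex.mul_im, Complex.zero_re,
      Complex.zero_im, add_lie, lie_add, smul_lie, lie_smul, hz, hz', hw, hw', h11, h12, h21,
      h22, h11', h12', h21', h22', hv, hv', lie_self]
    module
  exact ⟨LieEquiv.symm { LinearEquiv.ofInjectiveOfFinrankEq f hinj hfin with
    map_lie' := fun {p q} => hlie p q }⟩

end AffineComplex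

/-! ### Two-dimensional derived algebra: the action and its kernel -/

section DerivedTwoDim

variable {L : Type*} [LieRing L] [LieAlgebra ℝ L]

/-- The action of a Lie algebra on its derived algebra. -/
noncomputable def derivedAction (L : Type*) [LieRing L] [LieAlgebra ℝ L] :
    L →ₗ[ℝ] Module.End ℝ (LieAlgebra.derivedSeries ℝ L 1) :=
  LinearMap.mk₂ ℝ (fun x u => ⁅x, u⁆) add_lie smul_lie lie_add (fun c x u => lie_smul c x u)

@[simp] theorem derivedAction_apply (x : L) (u : LieAlgebra.derivedSeries ℝ L 1) :
    derivedAction L x u = ⁅x, u⁆ := rfl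

theorem mem_ker_derivedAction {x : L} : x ∈ LinearMap.ker (derivedAction L) ↔
    ∀ u ∈ LieAlgebra.derivedSeries ℝ L 1, ⁅x, u⁆ = 0 := by
  rw [LinearMap.mem_ker, LinearMap.ext_iff]
  constructor
  · intro h u hu
    exact congrArg Subtype.val (h ⟨u, hu⟩)
  · intro h u
    exact Subtype.ext (h u u.2)

/-- Brackets act as commutators of endomorphisms, which have trace zero. -/
theorem trace_derivedAction_of_mem {u : L} (hu : u ∈ LieAlgebra.derivedSeries ℝ L 1) :
    LinearMap.trace ℝ _ (derivedAction L u) = 0 := by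
  refine derivedSeries_one_induction (p := fun u => LinearMap.trace ℝ _ (derivedAction L u) = 0)
    (fun x y => ?_) (by simp) (fun x y hx hy => by rw [map_add, map_add, hx, hy, add_zero])
    (fun c x hx => by rw [map_smul, map_smul, hx, smul_zero]) hu
  have : derivedAction L ⁅x, y⁆ =
      derivedAction L x * derivedAction L y - derivedAction L y * derivedAction L x := by
    ext u
    simp [lie_lie]
  rw [this, map_sub, LinearMap.trace_mul_comm, sub_self]

/-- A derived algebra of dimension two is commutative. -/
theorem lie_eq_zero_of_mem_derivedSeries_one
    (h : Module.finrank ℝ (LieAlgebra.derivedSeries ℝ L 1) = 2) {u v : L}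
    (hu : u ∈ LieAlgebra.derivedSeries ℝ L 1) (hv : v ∈ LieAlgebra.derivedSeries ℝ L 1) :
    ⁅u, v⁆ = 0 := by
  set I := LieAlgebra.derivedSeries ℝ L 1
  have : FiniteDimensional ℝ I := FiniteDimensional.of_finrank_pos (by omega)
  let b : Module.Basis (Fin 2) ℝ I := Module.finBasisOfFinrankEq ℝ I h
  -- Up to sign, the traces of `ad (b 0)` and `ad (b 1)` are the two coordinates of `⁅b 0, b 1⁆`.
  have htr : ∀ i, b.repr ⁅(b i : L), b 0⁆ 0 + b.repr ⁅(b i : L), b 1⁆ 1 = 0 := fun i => by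
    have := trace_derivedAction_of_mem (b i).2
    rw [LinearMap.trace_eq_matrix_trace ℝ b, Matrix.trace_fin_two] at this
    rw [LinearMap.toMatrix_apply, LinearMap.toMatrix_apply] at this
    exact this
  have hself : ∀ i, ⁅(b i : L), b i⁆ = 0 := fun i => Subtype.ext (lie_self (b i : L))
  have hskew : ⁅(b 1 : L), b 0⁆ = -⁅(b 0 : L), b 1⁆ := Subtype.ext (lie_skew (b 1 : L) (b 0)).symm
  have h0 := htr 0
  have h1 := htr 1
  rw [hself] at h0 h1
  rw [hskew] at h1
  have hc : ⁅(b 0 : L), b 1⁆ = 0 := by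
    refine b.repr.injective (Finsupp.ext fun i => ?_)
    fin_cases i
    · simpa using h1
    · simpa using h0
  have hc' : ⁅(b 0 : L), (b 1 : L)⁆ = 0 := congrArg Subtype.val hc
  have hexp : ∀ u ∈ I, ∃ p q : ℝ, u = p • (b 0 : L) + q • (b 1 : L) := fun u hu => by
    refine ⟨b.repr ⟨u, hu⟩ 0, b.repr ⟨u, hu⟩ 1, ?_⟩
    have := congrArg Subtype.val (b.sum_repr ⟨u, hu⟩)
    rw [Fin.sum_univ_two] at this
    exact this.symm
  obtain ⟨p, q, rfl⟩ := hexp u hu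
  obtain ⟨r, s, rfl⟩ := hexp v hv
  simp [hc', ← lie_skew (b 1 : L) (b 0)]

/-- The Jacobi defect `⁅⁅x, y⁆, u⁆` is a bracket inside the commutative derived algebra. -/
theorem lie_lie_comm_of_mem_derivedSeries_one
    (h : Module.finrank ℝ (LieAlgebra.derivedSeries ℝ L 1) = 2) (x y : L) {u : L}
    (hu : u ∈ LieAlgebra.derivedSeries ℝ L 1) : ⁅x, ⁅y, u⁆⁆ = ⁅y, ⁅x, u⁆⁆ := by
  rw [leibniz_lie, lie_eq_zero_of_mem_derivedSeries_one h (lie_mem_derivedSeries_one x y) hu,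
    zero_add]

theorem mem_ker_derivedAction_of_mem_derivedSeries_one
    (h : Module.finrank ℝ (LieAlgebra.derivedSeries ℝ L 1) = 2) {u : L}
    (hu : u ∈ LieAlgebra.derivedSeries ℝ L 1) : u ∈ LinearMap.ker (derivedAction L) :=
  mem_ker_derivedAction.2 fun _ hv => lie_eq_zero_of_mem_derivedSeries_one h hu hv

theorem lie_lie_eq_zero_of_mem_ker_derivedAction {x y : L}
    (hx : x ∈ LinearMap.ker (derivedAction L)) (hy : y ∈ LinearMap.ker (derivedAction L)) (w : L) :
    ⁅w, ⁅x, y⁆⁆ = 0 := by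
  rw [leibniz_lie, mem_ker_derivedAction.1 hx _ (lie_mem_derivedSeries_one w y), add_zero,
    ← lie_skew, mem_ker_derivedAction.1 hy _ (lie_mem_derivedSeries_one w x), neg_zero]

/-- A linear form vanishing on a given subspace but not at a given vector outside of it. -/
theorem exists_dual_ne_zero_of_notMem {V : Type*} [AddCommGroup V] [Module ℝ V]
    {U : Submodule ℝ V} {x : V} (hx : x ∉ U) :
    ∃ F : Module.Dual ℝ V, F x ≠ 0 ∧ ∀ y ∈ U, F y = 0 := by
  obtain ⟨F, hF, hU⟩ := U.exists_dual_map_eq_bot_of_notMem hx inferInstance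
  refine ⟨F, hF, fun y hy => ?_⟩
  have : F y ∈ U.map F := ⟨y, hy, rfl⟩
  rwa [hU] at this

variable [FiniteDimensional ℝ L]

/-- By the Jacobi identity, brackets of elements of the kernel are central. A form that kills the
centre but not the derived algebra has this kernel as an isotropic subspace, and its rank is `n -
2`. -/
theorem finrank_ker_derivedAction_le
    (hnc : ¬ LieAlgebra.derivedSeries ℝ L 1 ≤ LieAlgebra.center ℝ L)
    (hrank : ∀ F : Module.Dual ℝ L, kirillovForm F ≠ 0 →
      Module.finrank ℝ (LinearMap.range (kirillovForm F)) + 2 = Module.finrank ℝ L) :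
    2 * Module.finrank ℝ (LinearMap.ker (derivedAction L)) ≤ Module.finrank ℝ L + 2 := by
  obtain ⟨u, hu, huc⟩ := SetLike.not_le_iff_exists.1 hnc
  obtain ⟨F, hFu, hF⟩ := exists_dual_ne_zero_of_notMem
    (U := (LieAlgebra.center ℝ L).toSubmodule) (x := u) huc
  have h1 := finrank_range_add_two_mul_finrank_le_of_isotropic (kirillovForm F)
    (LinearMap.ker (derivedAction L)) fun x hx y hy => by
      refine hF _ ?_
      change ⁅x, y⁆ ∈ LieAlgebra.center ℝ L
      rw [LieModule.mem_maxTrivSubmodule]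
      exact lie_lie_eq_zero_of_mem_ker_derivedAction hx hy
  have h2 := hrank F (kirillovForm_ne_zero hu hFu)
  omega

/-- Some element of `L` acts on the two-dimensional derived algebra with a cyclic vector. -/
theorem exists_cyclic_of_finrank_derivedSeries_eq_two (hdim : 6 ≤ Module.finrank ℝ L)
    (hker : 2 * Module.finrank ℝ (LinearMap.ker (derivedAction L)) ≤ Module.finrank ℝ L + 2) :
    ∃ t v : L, v ∈ LieAlgebra.derivedSeries ℝ L 1 ∧ LinearIndependent ℝ ![v, ⁅t, v⁆] := by
  have hrk := (derivedAction L).finrank_range_add_finrank_ker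
  by_contra! hall
  -- Without cyclic vectors every element acts by a scalar, so the kernel has codimension at most 1;
  -- the bound on it would give `n ≤ 4`.
  have hscal : LinearMap.range (derivedAction L) ≤
      Submodule.span ℝ {(LinearMap.id : Module.End ℝ (LieAlgebra.derivedSeries ℝ L 1))} := by
    rintro _ ⟨t, rfl⟩
    obtain ⟨a, ha⟩ := LinearMap.exists_eq_smul_id_of_forall_notLinearIndependent
      (f := derivedAction L t) fun v hv => hall t v v.2 (by
        rw [LinearIndependent.pair_iff] at hv ⊢
        exact fun a b hab => hv a b (Subtype.ext hab))
    exact Submodule.mem_span_singleton.2 ⟨a, ha.symm⟩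
  have h1 := (Submodule.finrank_mono hscal).trans (finrank_span_le_card _)
  simp at h1
  omega

end DerivedTwoDim

/-! ### Two-dimensional derived algebra: the complex structure -/

section DerivedTwoDim

variable {L : Type*} [LieRing L] [LieAlgebra ℝ L]

theorem exists_eq_smul_add_smul_of_mem_derivedSeries_one
    (h : Module.finrank ℝ (LieAlgebra.derivedSeries ℝ L 1) = 2) {v w : L}
    (hv : v ∈ LieAlgebra.derivedSeries ℝ L 1) (hw : w ∈ LieAlgebra.derivedSeries ℝ L 1)
    (hind : LinearIndependent ℝ ![v, w]) {u : L} (hu : u ∈ LieAlgebra.derivedSeries ℝ L 1) :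
    ∃ p q : ℝ, u = p • v + q • w := by
  have : FiniteDimensional ℝ (LieAlgebra.derivedSeries ℝ L 1).toSubmodule :=
    FiniteDimensional.of_finrank_pos (by
      change 0 < Module.finrank ℝ (LieAlgebra.derivedSeries ℝ L 1); omega)
  have hle : Submodule.span ℝ (Set.range ![v, w]) ≤
      (LieAlgebra.derivedSeries ℝ L 1).toSubmodule := by
    rw [Submodule.span_le]
    rintro _ ⟨i, rfl⟩
    fin_cases i
    · exact hv
    · exact hw
  have heq := Submodule.eq_of_le_of_finrank_eq hle (by
    rw [finrank_span_eq_card hind, Fintype.card_fin]; exact h.symm)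
  have hu' : u ∈ Submodule.span ℝ (Set.range ![v, w]) := by rw [heq]; exact hu
  rw [Matrix.range_cons, Matrix.range_cons, Matrix.range_empty, Set.union_empty,
    Set.singleton_union, Submodule.mem_span_pair] at hu'
  obtain ⟨p, q, hpq⟩ := hu'
  exact ⟨p, q, hpq.symm⟩

variable [FiniteDimensional ℝ L]

/-- If the derived algebra has a cyclic vector, some element of `L` acts on it as the identity. -/
theorem exists_lie_eq_self_of_cyclic
    (h : Module.finrank ℝ (LieAlgebra.derivedSeries ℝ L 1) = 2)
    (hdim : 6 ≤ Module.finrank ℝ L)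
    (hker : 2 * Module.finrank ℝ (LinearMap.ker (derivedAction L)) ≤ Module.finrank ℝ L + 2)
    {t v : L} (hv : v ∈ LieAlgebra.derivedSeries ℝ L 1)
    (hind : LinearIndependent ℝ ![v, ⁅t, v⁆]) :
    Module.finrank ℝ L = 6 ∧ Module.finrank ℝ (LinearMap.ker (derivedAction L)) = 4 ∧
      ∃ w : L, ∀ u ∈ LieAlgebra.derivedSeries ℝ L 1, ⁅w, u⁆ = u := by
  set I := LieAlgebra.derivedSeries ℝ L 1
  have htv : ⁅t, v⁆ ∈ I := lie_mem_derivedSeries_one t v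
  have hcyc : ∀ x y : L, ⁅x, v⁆ = ⁅y, v⁆ → ∀ u ∈ I, ⁅x, u⁆ = ⁅y, u⁆ := fun x y hxy u hu => by
    obtain ⟨p, q, rfl⟩ := exists_eq_smul_add_smul_of_mem_derivedSeries_one h hv htv hind hu
    rw [lie_add, lie_add, lie_smul, lie_smul, lie_smul, lie_smul,
      lie_lie_comm_of_mem_derivedSeries_one h x t hv,
      lie_lie_comm_of_mem_derivedSeries_one h y t hv, hxy]
  -- The action commutes with `t`, so it is determined by its value at the cyclic vector `v`. Hence
  -- the kernel has codimension at most 2, which with `hker` forces dimensions 6 and 4 and makes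
  -- `ev` onto.
  let ev : L →ₗ[ℝ] I := (derivedAction L).flip ⟨v, hv⟩
  have hev : ∀ x, (ev x : L) = ⁅x, v⁆ := fun x => rfl
  have hevker : LinearMap.ker ev ≤ LinearMap.ker (derivedAction L) := fun x hx => by
    have hx0 : ⁅x, v⁆ = 0 := by rw [← hev, LinearMap.mem_ker.1 hx]; rfl
    refine mem_ker_derivedAction.2 fun u hu => ?_
    rw [hcyc x 0 (by rw [hx0, zero_lie]) u hu, zero_lie]
  have h1 := ev.finrank_range_add_finrank_ker
  have h2 := Submodule.finrank_mono hevker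
  have h3 := Submodule.finrank_le (LinearMap.range ev)
  have h4 : Module.finrank ℝ I = 2 := h
  have hsurj : LinearMap.range ev = ⊤ :=
    Submodule.eq_top_of_finrank_eq (by omega)
  obtain ⟨w, hw⟩ := LinearMap.range_eq_top.1 hsurj ⟨v, hv⟩
  have hwv : ⁅w, v⁆ = v := congrArg Subtype.val hw
  refine ⟨by omega, by omega, w, fun u hu => ?_⟩
  obtain ⟨p, q, rfl⟩ := exists_eq_smul_add_smul_of_mem_derivedSeries_one h hv htv hind hu
  rw [lie_add, lie_smul, lie_smul, lie_lie_comm_of_mem_derivedSeries_one h w t hv, hwv]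

/-- Otherwise the kernel together with `w` would be isotropic of dimension 5, bounding the rank by 2
instead of 4. -/
theorem exists_mem_ker_derivedAction_apply_lie_ne_zero
    (hdim : Module.finrank ℝ L = 6)
    (hker : Module.finrank ℝ (LinearMap.ker (derivedAction L)) = 4)
    (hrank : ∀ F : Module.Dual ℝ L, kirillovForm F ≠ 0 →
      Module.finrank ℝ (LinearMap.range (kirillovForm F)) + 2 = Module.finrank ℝ L)
    (hcomm : ∀ x ∈ LinearMap.ker (derivedAction L), ∀ y ∈ LinearMap.ker (derivedAction L),
      ⁅x, y⁆ = 0)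
    {F : Module.Dual ℝ L} {u : L} (hu : u ∈ LieAlgebra.derivedSeries ℝ L 1) (hF : F u ≠ 0)
    {w : L} (hw : w ∉ LinearMap.ker (derivedAction L)) :
    ∃ k ∈ LinearMap.ker (derivedAction L), F ⁅w, k⁆ ≠ 0 := by
  by_contra! hall
  set K := LinearMap.ker (derivedAction L)
  have hall' : ∀ k ∈ K, F ⁅k, w⁆ = 0 := fun k hk => by
    rw [← lie_skew, map_neg, hall k hk, neg_zero]
  have h1 := finrank_range_add_two_mul_finrank_le_of_isotropic (kirillovForm F)
    (K ⊔ Submodule.span ℝ {w}) fun x hx y hy => by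
      obtain ⟨k, hk, s, hs, rfl⟩ := Submodule.mem_sup.1 hx
      obtain ⟨k', hk', s', hs', rfl⟩ := Submodule.mem_sup.1 hy
      obtain ⟨a, rfl⟩ := Submodule.mem_span_singleton.1 hs
      obtain ⟨b, rfl⟩ := Submodule.mem_span_singleton.1 hs'
      simp [hcomm k hk k' hk', hall k' hk', hall' k hk]
  have h2 := Submodule.finrank_lt_finrank_of_lt
    (show K < K ⊔ Submodule.span ℝ {w} from
      lt_of_le_of_ne le_sup_left fun heq => hw (by
        rw [heq]
        exact Submodule.mem_sup_right (Submodule.mem_span_singleton_self w)))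
  have h3 := hrank F (kirillovForm_ne_zero hu hF)
  omega

theorem nonempty_lieEquiv_of_finrank_derivedSeries_eq_two
    (h : Module.finrank ℝ (LieAlgebra.derivedSeries ℝ L 1) = 2)
    (hnc : ¬ LieAlgebra.derivedSeries ℝ L 1 ≤ LieAlgebra.center ℝ L)
    (hdim : 6 ≤ Module.finrank ℝ L)
    (hrank : ∀ F : Module.Dual ℝ L, kirillovForm F ≠ 0 →
      Module.finrank ℝ (LinearMap.range (kirillovForm F)) + 2 = Module.finrank ℝ L) :
    Nonempty (L ≃ₗ⁅ℝ⁆ AffineAlgebraComplex × AbelianAlgebra 2) := by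
  have hker := finrank_ker_derivedAction_le hnc hrank
  obtain ⟨t, v, hv, hind⟩ := exists_cyclic_of_finrank_derivedSeries_eq_two hdim hker
  obtain ⟨hdim6, hker4, w₁, hw₁⟩ := exists_lie_eq_self_of_cyclic h hdim hker hv hind
  set I := LieAlgebra.derivedSeries ℝ L 1
  set K := LinearMap.ker (derivedAction L)
  have hcomm : ∀ x ∈ K, ∀ y ∈ K, ⁅x, y⁆ = 0 := fun x hx y hy => by
    rw [← hw₁ ⁅x, y⁆ (lie_mem_derivedSeries_one x y)]
    exact lie_lie_eq_zero_of_mem_ker_derivedAction hx hy w₁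
  have hIK : ∀ u ∈ I, u ∈ K := fun u hu => mem_ker_derivedAction_of_mem_derivedSeries_one h hu
  have hlie : ∀ w : L, ∀ k ∈ K, ⁅w, ⁅w₁, k⁆⁆ = ⁅w, k⁆ := fun w k hk => by
    rw [leibniz_lie, hcomm _ (hIK _ (lie_mem_derivedSeries_one w w₁)) k hk, zero_add,
      hw₁ _ (lie_mem_derivedSeries_one w k)]
  -- If `w` did not map `I` onto itself, some `F` would kill `⁅w, I⁆` but not `I`. By `hlie`, it
  -- would kill `⁅w, K⁆` as well, against the previous lemma.
  have hinj : ∀ w ∉ K, ∀ u ∈ I, ⁅w, u⁆ = 0 → u = 0 := fun w hw => by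
    have hsurj : Function.Surjective (derivedAction L w) := by
      rw [← LinearMap.range_eq_top]
      by_contra hne
      obtain ⟨u, -, hu⟩ := SetLike.exists_of_lt (lt_top_iff_ne_top.2 hne)
      obtain ⟨F, hFu, hF⟩ := exists_dual_ne_zero_of_notMem
        (U := (LinearMap.range (derivedAction L w)).map I.toSubmodule.subtype) (x := (u : L)) (by
          rintro ⟨u', hu', hh⟩
          exact hu (Subtype.ext hh ▸ hu'))
      obtain ⟨k, hk, hFk⟩ := exists_mem_ker_derivedAction_apply_lie_ne_zero hdim6 hker4 hrank
        hcomm u.2 hFu hw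
      refine hFk ?_
      rw [← hlie w k hk]
      exact hF _ ⟨_, ⟨⟨⁅w₁, k⁆, lie_mem_derivedSeries_one w₁ k⟩, rfl⟩, rfl⟩
    have := LinearMap.injective_iff_surjective.2 hsurj
    intro u hu h0
    have h1 : derivedAction L w ⟨u, hu⟩ = derivedAction L w 0 := by
      rw [map_zero]; exact Subtype.ext h0
    exact congrArg Subtype.val (this h1)
  have htv : ⁅t, v⁆ ∈ I := lie_mem_derivedSeries_one t v
  have hpair := LinearIndependent.pair_iff.1 hind
  have hv0 : v ≠ 0 := fun h0 => by
    have := hpair 1 0 (by rw [h0]; simp)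
    simp at this
  obtain ⟨q, p, hqp⟩ := exists_eq_smul_add_smul_of_mem_derivedSeries_one h hv htv hind
    (lie_mem_derivedSeries_one t ⁅t, v⁆)
  -- A quarter of the discriminant of `X ^ 2 - p X - q`, the polynomial of `t` on `I`.
  set δ := q + p ^ 2 / 4 with hδ
  have hact : ∀ c : ℝ, ⁅t + c • w₁, v⁆ = ⁅t, v⁆ + c • v := fun c => by
    rw [add_lie, smul_lie, hw₁ v hv]
  have hact' : ∀ c : ℝ, ⁅t + c • w₁, ⁅t, v⁆⁆ = q • v + (p + c) • ⁅t, v⁆ := fun c => by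
    rw [add_lie, smul_lie, hw₁ _ htv, hqp]; module
  have hact0 : ∀ c : ℝ, ⁅t + c • w₁, v⁆ ≠ 0 := fun c h0 => by
    have := hpair c 1 (by rw [one_smul, add_comm, ← hact, h0])
    simp at this
  have hδneg : δ < 0 := by
    by_contra! hnn
    have hs := Real.sq_sqrt hnn
    -- For `δ ≥ 0` the polynomial factors over `ℝ`. Neither factor kills the cyclic vector `v`, so
    -- the outer one is injective on `I` and their product cannot kill `v`.
    refine hact0 (-(p / 2) + √δ) (hinj (t + (-(p / 2) - √δ) • w₁)
      (fun hk => hact0 _ (mem_ker_derivedAction.1 hk v hv)) _ (lie_mem_derivedSeries_one _ _) ?_)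
    rw [hact, lie_add, lie_smul, hact', hact]
    have : q + (-(p / 2) + √δ) * (-(p / 2) - √δ) = 0 := by rw [hδ] at hs; nlinarith
    calc _ = (q + (-(p / 2) + √δ) * (-(p / 2) - √δ)) • v := by module
      _ = 0 := by rw [this, zero_smul]
  set r := √(-δ) with hr
  have hr2 : r ^ 2 = -δ := Real.sq_sqrt (by linarith)
  have hr0 : r ≠ 0 := (Real.sqrt_pos.2 (by linarith)).ne'
  set j := r⁻¹ • (t + (-(p / 2)) • w₁) with hj
  have hjj : ⁅j, ⁅j, v⁆⁆ = -v := by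
    rw [hj, smul_lie, smul_lie, lie_smul, hact, lie_add, lie_smul, hact', hact]
    have hc : r⁻¹ * (r⁻¹ * δ) = -1 := by
      have : δ = -r ^ 2 := by linarith
      rw [this]; field_simp
    calc _ = (r⁻¹ * (r⁻¹ * δ)) • v := by rw [hδ]; module
      _ = -v := by rw [hc, neg_one_smul]
  have hjv : ⁅j, v⁆ ∈ I := lie_mem_derivedSeries_one j v
  have hu₀ : ⁅w₁, j⁆ ∈ I := lie_mem_derivedSeries_one w₁ j
  have hII : ∀ x ∈ I, ∀ y ∈ I, ⁅x, y⁆ = 0 := fun x hx y hy => hcomm x (hIK x hx) y (hIK y hy)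
  -- `ad w₁` maps the 4-dimensional `K` into the plane `I`. Vectors of its kernel are central by
  -- `hlie`.
  obtain ⟨z, hzind, hzK, hzw⟩ : ∃ z : Fin 2 → L, LinearIndependent ℝ z ∧ (∀ i, z i ∈ K) ∧
      ∀ i, ⁅w₁, z i⁆ = 0 := by
    let g : K →ₗ[ℝ] I := (LinearMap.codRestrict I.toSubmodule (LieAlgebra.ad ℝ L w₁ : L →ₗ[ℝ] L)
      fun x => lie_mem_derivedSeries_one w₁ x) ∘ₗ K.subtype
    have hg1 := g.finrank_range_add_finrank_ker
    have hg2 := Submodule.finrank_le (LinearMap.range g)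
    have hI2 : Module.finrank ℝ I = 2 := h
    obtain ⟨z, hz⟩ := exists_linearIndependent_of_le_finrank (R := ℝ) (M := LinearMap.ker g)
      (n := 2) (by omega)
    refine ⟨fun i => ((z i : K) : L), ?_, fun i => (z i : K).2, fun i => ?_⟩
    · exact (hz.map' _ (LinearMap.ker g).ker_subtype).map' _ K.ker_subtype
    · exact congrArg Subtype.val (LinearMap.mem_ker.1 (z i).2)
  -- Subtracting `⁅w₁, j⁆` makes `j` commute with `w₁` and, as `I` is commutative, does not change
  -- its action on `I`.
  refine nonempty_lieEquiv_affineAlgebraComplex hdim6 (w₁ := w₁) (w₂ := j - ⁅w₁, j⁆) (v₁ := v)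
    (v₂ := ⁅j, v⁆) ?_ (hw₁ v hv) (hw₁ _ hjv) ?_ ?_ (hII v hv _ hjv) hv0 (fun i x => ?_) hzind
  · rw [lie_sub, hw₁ _ hu₀, sub_self]
  · rw [sub_lie, hII _ hu₀ v hv, sub_zero]
  · rw [sub_lie, hII _ hu₀ _ hjv, sub_zero, hjj]
  · rw [← hlie x _ (hzK i), hzw, lie_zero]

end DerivedTwoDim

theorem mainTheorem4 (n : ℕ) (hn : 6 ≤ n)
    (L : Type u) [LieRing L] [LieAlgebra ℝ L] (hL : IsMDAlgebra.{u, v} (n - 2) n L) :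
    (Module.finrank ℝ (LieAlgebra.derivedSeries ℝ L 1) = 1 →
      ∃ m : ℕ, n = 2 * m + 2 ∧ Nonempty (L ≃ₗ⁅ℝ⁆ HeisenbergAlgebra m × AbelianAlgebra 1)) ∧
    (Module.finrank ℝ (LieAlgebra.derivedSeries ℝ L 1) = 2 →
      ¬ LieAlgebra.derivedSeries ℝ L 1 ≤ LieAlgebra.center ℝ L →
      Nonempty (L ≃ₗ⁅ℝ⁆ AffineAlgebraComplex × AbelianAlgebra 2)) := by
  have := hL.finiteDimensional
  have hdim := hL.finrank_eq
  have hrank : ∀ F : Module.Dual ℝ L, kirillovForm F ≠ 0 →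
      Module.finrank ℝ (LinearMap.range (kirillovForm F)) + 2 = Module.finrank ℝ L :=
    fun F hF => by rw [hL.finrank_range_kirillovForm F hF, hdim]; omega
  refine ⟨fun h => ?_, fun h hnc =>
    nonempty_lieEquiv_of_finrank_derivedSeries_eq_two h hnc (by omega) hrank⟩
  obtain ⟨F, z, hF, hz, hFz⟩ := exists_lie_eq_of_finrank_derivedSeries_eq_one h
  have hr := hrank F (kirillovForm_ne_zero hz (by rw [hF]; exact one_ne_zero))
  -- The rank is `n - 2 ≥ 4`, above the threshold 2 needed for `z` to be central.
  obtain ⟨m, hm, e⟩ := exists_lieEquiv_heisenberg hF hFz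
    (kirillovForm_eq_zero_of_lie_eq hFz (by omega)) hr
  exact ⟨m, by omega, e⟩
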